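/- Let $N\ge 1$ be an integer and let $p,q,a,b\ge 0$ be real numbers with $pq>1$ and $0\le a-b\le (N-2)(p-q)$. Put $\theta=\frac{pq(q+1)}{p+1}$ and assume $\theta\ge 1$ (so that $\theta-\sqrt\theta\ge 0$; this is automatic if $q\ge 1$ and $N\ge 3$). If $$N<2+2\left(\frac{p(b+2)+a+2}{pq-1}\right)\left(\sqrt{\theta}+\sqrt{\theta-\sqrt{\theta}}\right),$$ then the Hénon–Lane–Emden system $$-\Delta u=|x|^{a}v^{p},\qquad -\Delta v=|x|^{b}u^{q}\qquad\text{in }\mathbb{R}^N$$ has no positive pointwise stable classical solution. That is, there are no everywhere positive functions $u,v\in C^2(\mathbb{R}^N)$ that satisfy the system on $\mathbb{R}^N$ and for which there exist everywhere positive functions $\zeta,\eta\in C^2(\mathbb{R}^N)$ with $$-\Delta \zeta=p|x|^{a}v^{p-1}\eta,\qquad -\Delta \eta=q|x|^{b}u^{q-1}\zeta\qquad\text{in }\mathbb{R}^N.$$ -/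

import Mathlib

open scoped Laplacian

/-- `(u, v)` is a positive classical solution on `ℝ^N` of the Hénon-Lane-Emden system
`-Δ u = |x|^a v^p`, `-Δ v = |x|^b u^q`. -/
structure IsPositiveSolution (N : ℕ) (p q a b : ℝ) (u v : EuclideanSpace ℝ (Fin N) → ℝ) :
    Prop where
  contDiff_u : ContDiff ℝ 2 u
  contDiff_v : ContDiff ℝ 2 v
  u_pos : ∀ x, 0 < u x
  v_pos : ∀ x, 0 < v x
  eq_u : ∀ x, -(Δ u) x = ‖x‖ ^ a * v x ^ p
  eq_v : ∀ x, -(Δ v) x = ‖x‖ ^ b * u x ^ q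

/-- `(u, v)` is pointwise stable: the linearization of the system at `(u, v)` has a positive
classical solution `(ζ, η)` on `ℝ^N`. The regularity asked of `(ζ, η)` is `C²`, as for a classical
solution: the weight `|x|^a` is not smooth at the origin unless `a` is an even integer, so `C^∞`
would be too much to ask. -/
def IsPointwiseStable (N : ℕ) (p q a b : ℝ) (u v : EuclideanSpace ℝ (Fin N) → ℝ) : Prop :=
  ∃ ζ η : EuclideanSpace ℝ (Fin N) → ℝ,
    ContDiff ℝ 2 ζ ∧ ContDiff ℝ 2 η ∧ (∀ x, 0 < ζ x) ∧ (∀ x, 0 < η x) ∧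
    (∀ x, -(Δ ζ) x = p * ‖x‖ ^ a * v x ^ (p - 1) * η x) ∧
    (∀ x, -(Δ η) x = q * ‖x‖ ^ b * u x ^ (q - 1) * ζ x)

/-- The number `θ = p q (q + 1) / (p + 1)`. -/
noncomputable def stabTheta (p q : ℝ) : ℝ := p * q * (q + 1) / (p + 1)

/-!
A pointwise stable positive solution `(u, v)` is ruled out by integral estimates. Write
`X = -Δ u / u = |x|^a v^p / u`, `Y = -Δ v / v = |x|^b u^q / v` and `k = (p + 1) / (q + 1)`, so that
`θ = p q / k`. Four facts are combined.

* In dimension at most two, positive superharmonic functions are harmonic, so let `N ≥ 3`; then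
  `q ≤ p`. The comparison property `X ≤ k Y` (`comparison`, `superPotential_comparison`) holds
  because the positive part of `v - c |x|^{-s} u^σ`, with `σ = 1 / k` and `s = (a - b) / (p + 1)`,
  is subharmonic and lies below `v`, whose means over large balls tend to zero.
* Every positive `S` satisfies `∫ (-Δ S / S) φ² ≤ ∫ |∇ φ|²`. For the two components of the
  linearization this gives `√(p q) ∫ √(X Y) φ² ≤ ∫ |∇ φ|²` (`stability_inequality`), and for `v`
  itself it gives `∫ Y φ² ≤ ∫ |∇ φ|²`.
* With `φ = u^t χ`, the equation for `u` and the comparison property yield the energy estimate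
  `∫ |∇ φ|² ≤ C ∫ u^{2t} |∇ χ|²` whenever `t² / (2 t - 1) < √θ`, that is, for `t` between
  `√θ - √(θ - √θ)` and `√θ + √(θ - √θ)` (`energy_of_one_lt_theta`). If `θ = 1` this interval is
  empty, but the estimate persists for `t = 1` (`energy_of_theta_eq_one`): there `k > 1`, the
  deficit `√k √(X Y) - X` is controlled, and where it is small `u` is comparable to the power
  `z = v^k h^{1-k}` of `v`, with `h` a regularization of the superharmonic function
  `|x|^{-(a-b)/(p-q)}`. Testing the equations of `log u`, `log v`, `log h` against `(z χ)²` gains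
  gradient terms that control the rest (`critical_estimate`).
* Since `X Y^p = |x|^{a+bp} u^{pq-1}`, the sum `√(X Y) + Y` dominates `|x|^κ u^γ` with
  `κ = (a + b p) / (p + 1)` and `γ = (p q - 1) / (p + 1)`. Hence
  `∫ |x|^κ u^{2t+γ} χ² ≤ C ∫ u^{2t} |∇ χ|²`, and cutoffs at scale `R` bound the left side by a
  multiple of `R^{N - 2 - 2 t (κ + 2) / γ}` (`false_of_superlinear_energy`). The number
  `(κ + 2) / γ` is `(p (b + 2) + a + 2) / (p q - 1)`, so the exponent is negative for `t` close to
  `√θ + √(θ - √θ)`, contradicting `u > 0`.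

The inequality `∫ Y φ² ≤ ∫ |∇ φ|²` is what turns the energy estimate into a superlinear one, so that
no a priori integrability of powers of `u` is needed to start the argument.
-/

section

open MeasureTheory Filter Topology
open scoped Gradient RealInnerProductSpace

variable {N : ℕ}

local notation "𝔼" => EuclideanSpace ℝ (Fin N)

/-! ### Gradient and Laplacian calculus -/

theorem gradient_mul' {f g : 𝔼 → ℝ} {x : 𝔼} (hf : DifferentiableAt ℝ f x)
    (hg : DifferentiableAt ℝ g x) :
    ∇ (fun y => f y * g y) x = f x • ∇ g x + g x • ∇ f x := by
  simp only [gradient]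
  rw [fderiv_fun_mul hf hg]
  simp

theorem gradient_add' {f g : 𝔼 → ℝ} {x : 𝔼} (hf : DifferentiableAt ℝ f x)
    (hg : DifferentiableAt ℝ g x) :
    ∇ (fun y => f y + g y) x = ∇ f x + ∇ g x := by
  simp only [gradient]
  rw [fderiv_fun_add hf hg]
  simp

theorem gradient_const_mul' {f : 𝔼 → ℝ} {x : 𝔼} (c : ℝ) (hf : DifferentiableAt ℝ f x) :
    ∇ (fun y => c * f y) x = c • ∇ f x := by
  simp only [gradient]
  rw [fderiv_const_mul hf]
  simp

theorem gradient_comp' {F : ℝ → ℝ} {F' : ℝ} {f : 𝔼 → ℝ} {x : 𝔼} (hF : HasDerivAt F F' (f x))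
    (hf : DifferentiableAt ℝ f x) :
    ∇ (fun y => F (f y)) x = F' • ∇ f x := by
  simp only [gradient]
  have := (hF.comp_hasFDerivAt x hf.hasFDerivAt).fderiv
  simp only [Function.comp_def] at this
  rw [this]
  simp

theorem gradient_comp_const_smul {f : 𝔼 → ℝ} (hf : Differentiable ℝ f) (c : ℝ) (x₀ x : 𝔼) :
    ∇ (fun y => f (x₀ + c • y)) x = c • ∇ f (x₀ + c • x) := by
  have h1 : HasFDerivAt (fun y : 𝔼 => x₀ + c • y) (c • ContinuousLinearMap.id ℝ 𝔼) x :=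
    ((hasFDerivAt_id x).const_smul c).const_add x₀
  have := ((hf (x₀ + c • x)).hasFDerivAt.comp x h1).fderiv
  simp only [Function.comp_def] at this
  simp only [gradient, this]
  simp

theorem continuous_gradient {f : 𝔼 → ℝ} (hf : ContDiff ℝ 1 f) : Continuous (∇ f) := by
  unfold gradient
  exact (LinearIsometryEquiv.continuous _).comp (hf.continuous_fderiv one_ne_zero)

theorem gradient_norm_sq (x : 𝔼) : ∇ (fun y : 𝔼 => ‖y‖ ^ 2) x = (2 : ℝ) • x := by
  have h : HasGradientAt (fun y : 𝔼 => ‖y‖ ^ 2) ((2 : ℝ) • x) x := by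
    rw [hasGradientAt_iff_hasFDerivAt]
    have := (hasStrictFDerivAt_norm_sq x).hasFDerivAt
    refine this.congr_fderiv ?_
    ext y
    simp
  exact h.gradient

theorem inner_eq_sum_fderiv (f g : 𝔼 → ℝ) (x : 𝔼) :
    ⟪∇ f x, ∇ g x⟫ = ∑ i, fderiv ℝ f x (EuclideanSpace.basisFun (Fin N) ℝ i) *
      fderiv ℝ g x (EuclideanSpace.basisFun (Fin N) ℝ i) := by
  rw [← OrthonormalBasis.sum_inner_mul_inner (EuclideanSpace.basisFun (Fin N) ℝ)]
  refine Finset.sum_congr rfl fun i _ => ?_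
  rw [inner_gradient_left, real_inner_comm, inner_gradient_left]

theorem laplacian_eq_sum {f : 𝔼 → ℝ} {x : 𝔼} (hf : ContDiffAt ℝ 2 f x) :
    (Δ f) x = ∑ i, fderiv ℝ (fun y => fderiv ℝ f y (EuclideanSpace.basisFun (Fin N) ℝ i)) x
      (EuclideanSpace.basisFun (Fin N) ℝ i) := by
  rw [InnerProductSpace.laplacian_eq_iteratedFDeriv_orthonormalBasis f
    (EuclideanSpace.basisFun (Fin N) ℝ)]
  simp only
  refine Finset.sum_congr rfl fun i _ => ?_
  rw [iteratedFDeriv_two_apply]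
  have hd : DifferentiableAt ℝ (fderiv ℝ f) x :=
    (hf.fderiv_right (m := 1) (by norm_num)).differentiableAt (by norm_num)
  rw [fderiv_clm_apply hd (differentiableAt_const _)]
  simp

theorem continuous_laplacian {f : 𝔼 → ℝ} (hf : ContDiff ℝ 2 f) : Continuous (Δ f) := by
  have : Δ f = fun x => ∑ i, fderiv ℝ (fun y => fderiv ℝ f y
      (EuclideanSpace.basisFun (Fin N) ℝ i)) x (EuclideanSpace.basisFun (Fin N) ℝ i) :=
    funext fun x => laplacian_eq_sum hf.contDiffAt
  rw [this]
  refine continuous_finsetSum _ fun i _ => ?_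
  have : ContDiff ℝ 1 (fun y => fderiv ℝ f y (EuclideanSpace.basisFun (Fin N) ℝ i)) :=
    (hf.fderiv_right (by norm_num)).clm_apply contDiff_const
  exact (this.continuous_fderiv one_ne_zero).clm_apply continuous_const

/-- The chain rule `Δ (F ∘ f) = F' Δ f + F'' |∇ f|²`. -/
theorem laplacian_comp {F F₁ : ℝ → ℝ} {F₂ : ℝ} {f : 𝔼 → ℝ} {x : 𝔼} (hf : ContDiffAt ℝ 2 f x)
    (hc : ContDiffAt ℝ 2 F (f x))
    (hF : ∀ᶠ s in 𝓝 (f x), HasDerivAt F (F₁ s) s) (hF₁ : HasDerivAt F₁ F₂ (f x)) :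
    (Δ (fun y => F (f y))) x = F₁ (f x) * (Δ f) x + F₂ * ‖∇ f x‖ ^ 2 := by
  have hcomp : ContDiffAt ℝ 2 (fun y => F (f y)) x := hc.comp x hf
  rw [laplacian_eq_sum hcomp, laplacian_eq_sum hf, ← real_inner_self_eq_norm_sq,
    inner_eq_sum_fderiv, Finset.mul_sum, Finset.mul_sum, ← Finset.sum_add_distrib]
  refine Finset.sum_congr rfl fun i _ => ?_
  set e := EuclideanSpace.basisFun (Fin N) ℝ i
  have h1 : ∀ᶠ y in 𝓝 x, fderiv ℝ (fun y => F (f y)) y e = F₁ (f y) * fderiv ℝ f y e := by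
    have hd : ∀ᶠ y in 𝓝 x, DifferentiableAt ℝ f y :=
      (hf.eventually (by simp)).mono fun y hy => hy.differentiableAt (by norm_num)
    filter_upwards [hd, hf.continuousAt.eventually hF] with y hy hFy
    have := (hFy.comp_hasFDerivAt y hy.hasFDerivAt).fderiv
    simp only [Function.comp_def] at this
    rw [this]
    simp
  rw [Filter.EventuallyEq.fderiv_eq h1]
  have hd : DifferentiableAt ℝ (fun y => fderiv ℝ f y e) x :=
    ((hf.fderiv_right (m := 1) (by norm_num)).clm_apply contDiffAt_const).differentiableAt
      (by norm_num)
  have hdf : DifferentiableAt ℝ f x := hf.differentiableAt (by norm_num)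
  have h2 := (hF₁.comp_hasFDerivAt x hdf.hasFDerivAt).mul hd.hasFDerivAt
  simp only [Function.comp_def] at h2
  have h3 := h2.fderiv
  rw [show (fun y => F₁ (f y) * fderiv ℝ f y e) = (fun y => F₁ (f y)) * fun y => fderiv ℝ f y e
    from rfl, h3]
  simp
  ring

theorem laplacian_comp_const_smul {f : 𝔼 → ℝ} (hf : ContDiff ℝ 2 f) (c : ℝ) (x₀ x : 𝔼) :
    (Δ (fun y => f (x₀ + c • y))) x = c ^ 2 * (Δ f) (x₀ + c • x) := by
  have hg : ContDiff ℝ 2 (fun y => f (x₀ + c • y)) := hf.comp (by fun_prop)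
  rw [laplacian_eq_sum hg.contDiffAt, laplacian_eq_sum hf.contDiffAt, Finset.mul_sum]
  refine Finset.sum_congr rfl fun i _ => ?_
  set e := EuclideanSpace.basisFun (Fin N) ℝ i
  have key : ∀ (g : 𝔼 → ℝ), Differentiable ℝ g → ∀ y, fderiv ℝ (fun y => g (x₀ + c • y)) y e =
      c * fderiv ℝ g (x₀ + c • y) e := by
    intro g hg y
    have := gradient_comp_const_smul hg c x₀ y
    rw [← inner_gradient_left, this, inner_smul_left, inner_gradient_left]
    simp
  have h1 : (fun y => fderiv ℝ (fun y => f (x₀ + c • y)) y e) =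
      fun y => c * fderiv ℝ f (x₀ + c • y) e :=
    funext fun y => key f (hf.differentiable (by norm_num)) y
  rw [h1]
  have hd : Differentiable ℝ (fun y => fderiv ℝ f y e) :=
    ((hf.fderiv_right (m := 1) (by norm_num)).clm_apply contDiff_const).differentiable
      (by norm_num)
  have h2 := key (fun y => c * fderiv ℝ f y e) (hd.const_mul c) x
  rw [h2, fderiv_const_mul hd.differentiableAt]
  simp
  ring

/-- Integration by parts: `∫ (-Δ f) g = ∫ ∇ f · ∇ g` for `g` of compact support. -/
theorem integral_neg_laplacian_mul {f g : 𝔼 → ℝ} (hf : ContDiff ℝ 2 f) (hg : ContDiff ℝ 1 g)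
    (hc : HasCompactSupport g) :
    ∫ x, -(Δ f) x * g x = ∫ x, ⟪∇ f x, ∇ g x⟫ := by
  set e := fun i => EuclideanSpace.basisFun (Fin N) ℝ i
  have hfi : ∀ i, ContDiff ℝ 1 (fun y => fderiv ℝ f y (e i)) := fun i =>
    (hf.fderiv_right (by norm_num)).clm_apply contDiff_const
  have cf1 : ∀ i, Continuous fun x => fderiv ℝ (fun y => fderiv ℝ f y (e i)) x (e i) := fun i =>
    ((hfi i).continuous_fderiv one_ne_zero).clm_apply continuous_const
  have cg1 : ∀ i, Continuous fun x => fderiv ℝ g x (e i) := fun i =>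
    (hg.continuous_fderiv one_ne_zero).clm_apply continuous_const
  have sg1 : ∀ i, HasCompactSupport fun x => fderiv ℝ g x (e i) := fun i =>
    hc.fderiv_apply ℝ (e i)
  have i1 : ∀ i, Integrable fun x => fderiv ℝ (fun y => fderiv ℝ f y (e i)) x (e i) * g x :=
    fun i => ((cf1 i).mul hg.continuous).integrable_of_hasCompactSupport hc.mul_left
  have i1n : ∀ i, Integrable fun x => -(fderiv ℝ (fun y => fderiv ℝ f y (e i)) x (e i) * g x) :=
    fun i => (i1 i).neg
  have i2 : ∀ i, Integrable fun x => fderiv ℝ f x (e i) * fderiv ℝ g x (e i) :=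
    fun i => ((hfi i).continuous.mul (cg1 i)).integrable_of_hasCompactSupport (sg1 i).mul_left
  have i3 : ∀ i, Integrable fun x => fderiv ℝ f x (e i) * g x :=
    fun i => ((hfi i).continuous.mul hg.continuous).integrable_of_hasCompactSupport hc.mul_left
  have key : ∀ i, ∫ x, fderiv ℝ f x (e i) * fderiv ℝ g x (e i) =
      -∫ x, fderiv ℝ (fun y => fderiv ℝ f y (e i)) x (e i) * g x := fun i =>
    integral_mul_fderiv_eq_neg_fderiv_mul_of_integrable (i1 i) (i2 i) (i3 i)
      (fun x _ => (hfi i).differentiable (by norm_num) x)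
      (fun x _ => hg.differentiable (by norm_num) x)
  have h1 : ∀ x, -(Δ f) x * g x =
      ∑ i, -(fderiv ℝ (fun y => fderiv ℝ f y (e i)) x (e i) * g x) := by
    intro x
    rw [laplacian_eq_sum hf.contDiffAt, neg_mul, Finset.sum_mul, Finset.sum_neg_distrib]
  simp_rw [h1, inner_eq_sum_fderiv]
  rw [integral_finsetSum _ (fun i _ => i1n i), integral_finsetSum _ (fun i _ => i2 i)]
  refine Finset.sum_congr rfl fun i _ => ?_
  rw [integral_neg]
  exact (key i).symm

/-! ### Weighted means of subharmonic and superharmonic functions -/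

/-- Extending a differentiable function on `[0, ∞)` by zero to the left of `0`, when both the
function and its derivative vanish at `0`. -/
theorem hasDerivAt_extend_zero {f f' : ℝ → ℝ} (hf : ∀ s, 0 ≤ s → HasDerivAt f (f' s) s)
    (h0 : f 0 = 0) (h0' : f' 0 = 0) (s : ℝ) :
    HasDerivAt (fun s => if 0 ≤ s then f s else 0) (if 0 ≤ s then f' s else 0) s := by
  rcases lt_trichotomy s 0 with hs | rfl | hs
  · rw [if_neg hs.not_ge]
    refine (hasDerivAt_const s (0 : ℝ)).congr_of_eventuallyEq ?_
    filter_upwards [Iio_mem_nhds hs] with y hy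
    rw [if_neg (not_le.2 hy)]
  · rw [if_pos le_rfl, h0']
    have h1 : HasDerivWithinAt (fun s => if 0 ≤ s then f s else 0) 0 (Set.Ici 0) 0 := by
      have := (hf 0 le_rfl).hasDerivWithinAt (s := Set.Ici 0)
      rw [h0'] at this
      refine this.congr (fun y hy => if_pos hy) (if_pos le_rfl)
    have h2 : HasDerivWithinAt (fun s => if 0 ≤ s then f s else 0) 0 (Set.Iic 0) 0 := by
      refine (hasDerivWithinAt_const (0 : ℝ) (Set.Iic 0) (0 : ℝ)).congr (fun y hy => ?_) ?_
      · rcases eq_or_lt_of_le (show y ≤ 0 from hy) with rfl | hy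
        · simp [h0]
        · rw [if_neg hy.not_ge]
      · simp [h0]
    have := h1.union h2
    rwa [Set.Ici_union_Iic, hasDerivWithinAt_univ] at this
  · rw [if_pos hs.le]
    refine (hf s hs.le).congr_of_eventuallyEq ?_
    filter_upwards [Ioi_mem_nhds hs] with y hy
    rw [if_pos (le_of_lt hy)]

theorem hasDerivAt_max_zero_sq (s : ℝ) :
    HasDerivAt (fun s : ℝ => (max 0 s) ^ 2) (2 * max 0 s) s := by
  have := hasDerivAt_extend_zero (f := fun s => s ^ 2) (f' := fun s => 2 * s)
    (fun s _ => by simpa using hasDerivAt_pow 2 s) (by simp) (by simp) s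
  have e1 : (fun s : ℝ => if 0 ≤ s then s ^ 2 else 0) = fun s => (max 0 s) ^ 2 := by
    funext s
    split_ifs with h
    · rw [max_eq_right h]
    · rw [max_eq_left (not_le.1 h).le]; simp
  have e2 : (if 0 ≤ s then 2 * s else 0) = 2 * max 0 s := by
    split_ifs with h
    · rw [max_eq_right h]
    · rw [max_eq_left (not_le.1 h).le]; simp
  rw [← e1, ← e2]
  exact this

/-- The averaging kernel `(1 - |y|²)₊`. -/
noncomputable def meanKernel (y : 𝔼) : ℝ := max 0 (1 - ‖y‖ ^ 2)

/-- The potential `(1 - |y|²)₊² / 4` of the averaging kernel: its gradient is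
`-meanKernel y • y`. -/
noncomputable def meanPotential (y : 𝔼) : ℝ := meanKernel y ^ 2 / 4

theorem meanKernel_nonneg (y : 𝔼) : 0 ≤ meanKernel y := le_max_left _ _

theorem meanPotential_nonneg (y : 𝔼) : 0 ≤ meanPotential y := by
  unfold meanPotential; positivity

theorem continuous_meanKernel : Continuous (meanKernel : 𝔼 → ℝ) := by
  unfold meanKernel; fun_prop

theorem hasCompactSupport_meanKernel : HasCompactSupport (meanKernel : 𝔼 → ℝ) := by
  refine HasCompactSupport.intro (isCompact_closedBall (0 : 𝔼) 1) fun x hx => ?_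
  have hx : 1 < ‖x‖ := by simpa using hx
  exact max_eq_left (by nlinarith)

theorem norm_le_one_of_meanKernel_ne_zero {y : 𝔼} (hy : meanKernel y ≠ 0) : ‖y‖ ≤ 1 := by
  by_contra! h
  exact hy (max_eq_left (by nlinarith))

theorem hasCompactSupport_meanPotential : HasCompactSupport (meanPotential : 𝔼 → ℝ) := by
  refine hasCompactSupport_meanKernel.mono' fun y hy => subset_closure ?_
  intro h
  apply hy
  simp [meanPotential, h]

theorem meanPotential_aux (s : ℝ) :
    HasDerivAt (fun s : ℝ => (max 0 (1 - s)) ^ 2 / 4) (-(max 0 (1 - s)) / 2) s := by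
  have h := (hasDerivAt_max_zero_sq (1 - s)).comp s ((hasDerivAt_id s).const_sub 1)
  have h2 := h.div_const 4
  exact h2.congr_deriv (by ring)

theorem contDiff_meanPotential : ContDiff ℝ 1 (meanPotential : 𝔼 → ℝ) := by
  have h : ContDiff ℝ 1 (fun s : ℝ => (max 0 (1 - s)) ^ 2 / 4) := by
    rw [contDiff_one_iff_deriv]
    refine ⟨fun s => (meanPotential_aux s).differentiableAt, ?_⟩
    rw [show deriv (fun s : ℝ => (max 0 (1 - s)) ^ 2 / 4) = fun s => -(max 0 (1 - s)) / 2 from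
      funext fun s => (meanPotential_aux s).deriv]
    fun_prop
  exact h.comp (contDiff_norm_sq ℝ)

theorem gradient_meanPotential (y : 𝔼) :
    ∇ (meanPotential : 𝔼 → ℝ) y = -(meanKernel y) • y := by
  have := gradient_comp' (f := fun y : 𝔼 => ‖y‖ ^ 2) (meanPotential_aux (‖y‖ ^ 2))
    ((contDiff_norm_sq (n := 1) ℝ).differentiable (by norm_num) y)
  rw [gradient_norm_sq] at this
  rw [show (meanPotential : 𝔼 → ℝ) = fun y => (max 0 (1 - ‖y‖ ^ 2)) ^ 2 / 4 from rfl, this,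
    smul_smul]
  congr 1
  unfold meanKernel
  ring

/-- The weighted mean `∫ f (x₀ + t y) (1 - |y|²)₊ dy`. -/
noncomputable def weightedMean (f : 𝔼 → ℝ) (x₀ : 𝔼) (t : ℝ) : ℝ :=
  ∫ y, f (x₀ + t • y) * meanKernel y

theorem hasDerivAt_weightedMean_aux {f : 𝔼 → ℝ} (hf : ContDiff ℝ 1 f) (x₀ : 𝔼) (t : ℝ) :
    HasDerivAt (weightedMean f x₀) (∫ y, ⟪∇ f (x₀ + t • y), y⟫ * meanKernel y) t := by
  have cg := continuous_gradient hf
  obtain ⟨C, hC⟩ := ((isCompact_closedBall t 1).prod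
      (isCompact_closedBall (0 : 𝔼) 1)).exists_bound_of_continuousOn
    (f := fun z : ℝ × 𝔼 => ⟪∇ f (x₀ + z.1 • z.2), z.2⟫)
    (Continuous.continuousOn (by fun_prop))
  refine (hasDerivAt_integral_of_dominated_loc_of_deriv_le (μ := volume)
    (F := fun t y => f (x₀ + t • y) * meanKernel y)
    (F' := fun t y => ⟪∇ f (x₀ + t • y), y⟫ * meanKernel y)
    (bound := fun y => C * meanKernel y) (Metric.closedBall_mem_nhds t one_pos)
    (.of_forall fun s => ?_) ?_ ?_ (.of_forall fun y s hs => ?_) ?_ (.of_forall fun y s _ => ?_)).2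
  · exact (Continuous.mul (hf.continuous.comp (by fun_prop))
      continuous_meanKernel).aestronglyMeasurable
  · exact (Continuous.mul (hf.continuous.comp (by fun_prop))
      continuous_meanKernel).integrable_of_hasCompactSupport hasCompactSupport_meanKernel.mul_left
  · exact (Continuous.mul (by fun_prop) continuous_meanKernel).aestronglyMeasurable
  · by_cases h : meanKernel y = 0
    · simp [h]
    · rw [norm_mul, Real.norm_of_nonneg (meanKernel_nonneg y)]
      refine mul_le_mul_of_nonneg_right ?_ (meanKernel_nonneg y)
      exact hC (s, y) ⟨hs, by simpa using norm_le_one_of_meanKernel_ne_zero h⟩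
  · exact (continuous_meanKernel.integrable_of_hasCompactSupport
      hasCompactSupport_meanKernel).const_mul C
  · refine HasDerivAt.mul_const ?_ _
    have h1 : HasDerivAt (fun s : ℝ => x₀ + s • y) y s := by
      simpa using ((hasDerivAt_id s).smul_const y).const_add x₀
    have := (hf.differentiable (by norm_num) (x₀ + s • y)).hasFDerivAt.comp_hasDerivAt s h1
    rw [inner_gradient_left]
    exact this

/-- The derivative of the weighted means is an average of the Laplacian. -/
theorem hasDerivAt_weightedMean {f : 𝔼 → ℝ} (hf : ContDiff ℝ 2 f) (x₀ : 𝔼) {t : ℝ} (ht : t ≠ 0) :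
    HasDerivAt (weightedMean f x₀) (t * ∫ y, (Δ f) (x₀ + t • y) * meanPotential y) t := by
  convert hasDerivAt_weightedMean_aux (hf.of_le (by norm_num)) x₀ t using 1
  have hg : ContDiff ℝ 2 (fun y => f (x₀ + t • y)) := hf.comp (by fun_prop)
  have h := integral_neg_laplacian_mul hg contDiff_meanPotential hasCompactSupport_meanPotential
  simp_rw [gradient_meanPotential, laplacian_comp_const_smul hf,
    gradient_comp_const_smul (hf.differentiable (by norm_num)), inner_smul_left, inner_smul_right]
    at h
  have e1 : ∀ y : 𝔼, -(t ^ 2 * (Δ f) (x₀ + t • y)) * meanPotential y =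
      -t ^ 2 * ((Δ f) (x₀ + t • y) * meanPotential y) := fun y => by ring
  have e2 : ∀ y : 𝔼, (starRingEnd ℝ) t * (-meanKernel y * ⟪∇ f (x₀ + t • y), y⟫) =
      -t * (⟪∇ f (x₀ + t • y), y⟫ * meanKernel y) := fun y => by
    rw [conj_trivial]; ring
  simp_rw [e1, e2] at h
  rw [integral_const_mul, integral_const_mul] at h
  have : -t * (t * ∫ y, (Δ f) (x₀ + t • y) * meanPotential y) =
      -t * ∫ y, ⟪∇ f (x₀ + t • y), y⟫ * meanKernel y := by rw [← h]; ring
  exact mul_left_cancel₀ (neg_ne_zero.2 ht) this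

theorem weightedMean_zero (f : 𝔼 → ℝ) (x₀ : 𝔼) :
    weightedMean f x₀ 0 = f x₀ * ∫ y : 𝔼, meanKernel y := by
  simp [weightedMean, integral_const_mul]

theorem le_weightedMean_of_subharmonic {f : 𝔼 → ℝ} (hf : ContDiff ℝ 2 f) (hΔ : ∀ x, 0 ≤ (Δ f) x)
    (x₀ : 𝔼) {t : ℝ} (ht : 0 ≤ t) :
    f x₀ * ∫ y : 𝔼, meanKernel y ≤ weightedMean f x₀ t := by
  have hm : MonotoneOn (weightedMean f x₀) (Set.Ici 0) := by
    refine monotoneOn_of_deriv_nonneg (convex_Ici 0)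
      (fun t _ => (hasDerivAt_weightedMean_aux (hf.of_le (by norm_num)) x₀
        t).continuousAt.continuousWithinAt)
      (fun t _ => (hasDerivAt_weightedMean_aux (hf.of_le (by norm_num)) x₀
        t).differentiableAt.differentiableWithinAt) fun t ht => ?_
    rw [interior_Ici] at ht
    rw [(hasDerivAt_weightedMean hf x₀ (ne_of_gt ht)).deriv]
    exact mul_nonneg (le_of_lt ht)
      (integral_nonneg fun y => mul_nonneg (hΔ _) (meanPotential_nonneg y))
  rw [← weightedMean_zero]
  exact hm Set.self_mem_Ici ht ht

theorem weightedMean_le_of_superharmonic {f : 𝔼 → ℝ} (hf : ContDiff ℝ 2 f)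
    (hΔ : ∀ x, 0 ≤ -(Δ f) x) (x₀ : 𝔼) {t : ℝ} (ht : 0 ≤ t) :
    weightedMean f x₀ t ≤ f x₀ * ∫ y : 𝔼, meanKernel y := by
  have h := le_weightedMean_of_subharmonic (f := -f) hf.neg
    (fun x => by simpa [InnerProductSpace.laplacian_neg] using hΔ x) x₀ ht
  have e : weightedMean (-f) x₀ t = -weightedMean f x₀ t := by
    simp [weightedMean, integral_neg]
  rw [e, Pi.neg_apply] at h
  linarith

theorem integral_meanKernel_pos : 0 < ∫ y : 𝔼, meanKernel y := by
  refine continuous_meanKernel.integral_pos_of_hasCompactSupport_nonneg_nonzero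
    hasCompactSupport_meanKernel meanKernel_nonneg (x := 0) ?_
  simp [meanKernel]

theorem meanPotential_zero_ne : meanPotential (0 : 𝔼) ≠ 0 := by
  simp [meanPotential, meanKernel]

/-- There is no positive function whose negative Laplacian is too large on average: the derivative
of its weighted means would be at most `-c / t`, so that they would tend to `-∞` like `-c log t`. -/
theorem not_pos_of_mean_laplacian_le {f : 𝔼 → ℝ} (hf : ContDiff ℝ 2 f) (hpos : ∀ x, 0 < f x)
    {c : ℝ} (hc : 0 < c)
    (h : ∀ t : ℝ, 1 ≤ t → c / t ^ 2 ≤ ∫ y, -(Δ f) (t • y) * meanPotential y) : False := by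
  have hd : ∀ t : ℝ, 1 ≤ t → HasDerivAt (fun t => weightedMean f 0 t + c * Real.log t)
      (t * (∫ y, (Δ f) (t • y) * meanPotential y) + c * t⁻¹) t := by
    intro t ht
    have h1 := hasDerivAt_weightedMean hf 0 (t := t) (by linarith)
    simp only [zero_add] at h1
    exact h1.add ((Real.hasDerivAt_log (by linarith)).const_mul c)
  have ha : AntitoneOn (fun t => weightedMean f 0 t + c * Real.log t) (Set.Ici 1) := by
    refine antitoneOn_of_deriv_nonpos (convex_Ici 1)
      (fun t ht => (hd t ht).continuousAt.continuousWithinAt)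
      (fun t ht => (hd t (interior_subset ht)).differentiableAt.differentiableWithinAt)
      fun t ht => ?_
    have ht : 1 ≤ t := interior_subset ht
    rw [(hd t ht).deriv]
    have h2 := h t ht
    simp only [neg_mul, integral_neg] at h2
    have ht0 : 0 < t := by linarith
    have h3 : t * (c / t ^ 2) ≤ t * -∫ y, (Δ f) (t • y) * meanPotential y :=
      mul_le_mul_of_nonneg_left h2 ht0.le
    have h4 : t * (c / t ^ 2) = c * t⁻¹ := by field_simp
    linarith
  have hM : ∀ t, 0 ≤ weightedMean f 0 t := fun t =>
    integral_nonneg fun y => mul_nonneg (hpos _).le (meanKernel_nonneg y)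
  set t := Real.exp ((weightedMean f 0 1 + 1) / c)
  have ht : 1 ≤ t := Real.one_le_exp (by have := hM 1; positivity)
  have := ha Set.self_mem_Ici ht ht
  simp only [Real.log_one, mul_zero, add_zero] at this
  rw [Real.log_exp, mul_div_cancel₀ _ hc.ne'] at this
  linarith [hM t]

/-- A weak Harnack inequality: a mean of a positive superharmonic function around one point bounds
its value at any other point from below. -/
theorem weightedMean_le_mul_of_superharmonic {f : 𝔼 → ℝ} (hf : ContDiff ℝ 2 f)
    (hpos : ∀ x, 0 < f x) (hΔ : ∀ x, 0 ≤ -(Δ f) x) (x₀ y : 𝔼) {t : ℝ} (ht : 0 < t)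
    (hty : 2 * ‖x₀ - y‖ ≤ t) :
    weightedMean f x₀ t ≤ 2 ^ (N + 2) * (f y * ∫ z : 𝔼, meanKernel z) := by
  have h1 := weightedMean_le_of_superharmonic hf hΔ y (t := 2 * t) (by linarith)
  have h2 : weightedMean f y (2 * t) =
      (2 ^ N : ℝ)⁻¹ * ∫ z, f (y + (2 * t) • ((2 : ℝ)⁻¹ • z + (2 * t)⁻¹ • (x₀ - y))) *
        meanKernel ((2 : ℝ)⁻¹ • z + (2 * t)⁻¹ • (x₀ - y)) := by
    have e1 := integral_add_right_eq_self (μ := (volume : Measure 𝔼))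
      (fun z => f (y + (2 * t) • z) * meanKernel z) ((2 * t)⁻¹ • (x₀ - y))
    have e2 := Measure.integral_comp_smul (volume : Measure 𝔼)
      (fun z => f (y + (2 * t) • (z + (2 * t)⁻¹ • (x₀ - y))) *
        meanKernel (z + (2 * t)⁻¹ • (x₀ - y))) (2 : ℝ)⁻¹
    rw [e2, e1]
    simp only [weightedMean, finrank_euclideanSpace, Fintype.card_fin]
    rw [smul_eq_mul, abs_of_pos (by positivity), ← mul_assoc]
    simp
  have h3 : ∀ z : 𝔼, y + (2 * t) • ((2 : ℝ)⁻¹ • z + (2 * t)⁻¹ • (x₀ - y)) = x₀ + t • z := by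
    intro z
    rw [smul_add, smul_smul, smul_smul, mul_inv_cancel₀ (by positivity), one_smul]
    rw [show 2 * t * (2 : ℝ)⁻¹ = t by ring]
    abel
  simp_rw [h3] at h2
  have h4 : weightedMean f x₀ t ≤ ∫ z, 4 * (f (x₀ + t • z) *
      meanKernel ((2 : ℝ)⁻¹ • z + (2 * t)⁻¹ • (x₀ - y))) := by
    have cc : Continuous fun z : 𝔼 => (2 : ℝ)⁻¹ • z + (2 * t)⁻¹ • (x₀ - y) := by fun_prop
    have cs : HasCompactSupport fun z : 𝔼 =>
        meanKernel ((2 : ℝ)⁻¹ • z + (2 * t)⁻¹ • (x₀ - y)) := by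
      refine HasCompactSupport.intro (isCompact_closedBall (0 : 𝔼) 3) fun z hz => ?_
      have hz : 3 < ‖z‖ := by simpa using hz
      by_contra h
      have h5 := norm_le_one_of_meanKernel_ne_zero h
      have h6 : ‖(2 : ℝ)⁻¹ • z‖ - ‖(2 * t)⁻¹ • (x₀ - y)‖ ≤ 1 := by
        have := norm_sub_le ((2 : ℝ)⁻¹ • z + (2 * t)⁻¹ • (x₀ - y)) ((2 * t)⁻¹ • (x₀ - y))
        rw [add_sub_cancel_right] at this
        linarith
      have h7 : ‖(2 * t)⁻¹ • (x₀ - y)‖ ≤ 1 / 4 := by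
        rw [norm_smul, Real.norm_of_nonneg (by positivity), inv_mul_le_iff₀ (by positivity)]
        linarith
      rw [norm_smul, Real.norm_of_nonneg (by positivity)] at h6
      linarith
    refine integral_mono
      ((Continuous.mul (hf.continuous.comp (by fun_prop))
        continuous_meanKernel).integrable_of_hasCompactSupport
        hasCompactSupport_meanKernel.mul_left)
      (((Continuous.mul (hf.continuous.comp (by fun_prop))
        (continuous_meanKernel.comp cc)).integrable_of_hasCompactSupport
        cs.mul_left).const_mul 4) fun z => ?_
    simp only
    by_cases hz : meanKernel z = 0
    · rw [hz, mul_zero]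
      exact mul_nonneg (by norm_num) (mul_nonneg (hpos _).le (meanKernel_nonneg _))
    have hz1 := norm_le_one_of_meanKernel_ne_zero hz
    have h7 : ‖(2 * t)⁻¹ • (x₀ - y)‖ ≤ 1 / 4 := by
      rw [norm_smul, Real.norm_of_nonneg (by positivity), inv_mul_le_iff₀ (by positivity)]
      linarith
    have h8 : ‖(2 : ℝ)⁻¹ • z + (2 * t)⁻¹ • (x₀ - y)‖ ≤ 3 / 4 := by
      refine (norm_add_le _ _).trans ?_
      rw [norm_smul, Real.norm_of_nonneg (by positivity)]
      linarith
    have h9 : meanKernel z ≤ 1 := max_le zero_le_one (by nlinarith [sq_nonneg ‖z‖])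
    have h10 : 1 / 4 ≤ meanKernel ((2 : ℝ)⁻¹ • z + (2 * t)⁻¹ • (x₀ - y)) := by
      refine le_max_of_le_right ?_
      nlinarith [norm_nonneg ((2 : ℝ)⁻¹ • z + (2 * t)⁻¹ • (x₀ - y))]
    nlinarith [hpos (x₀ + t • z)]
  rw [integral_const_mul] at h4
  have h5 : ∫ z, f (x₀ + t • z) * meanKernel ((2 : ℝ)⁻¹ • z + (2 * t)⁻¹ • (x₀ - y)) ≤
      2 ^ N * (f y * ∫ z : 𝔼, meanKernel z) := by
    rw [h2, inv_mul_le_iff₀ (by positivity)] at h1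
    exact h1
  calc _ ≤ _ := h4
    _ ≤ 4 * (2 ^ N * (f y * ∫ z : 𝔼, meanKernel z)) := by gcongr
    _ = _ := by rw [pow_add]; ring

/-! ### Superharmonic functions on the whole space, and a smooth positive part -/

/-- In dimension at most two a positive superharmonic function is harmonic: the derivative of its
weighted means is at most a negative multiple of `t^{1-N}`, which is not integrable at infinity. -/
theorem laplacian_eq_zero_of_dim_le_two (hN : N ≤ 2) {f : 𝔼 → ℝ} (hf : ContDiff ℝ 2 f)
    (hpos : ∀ x, 0 < f x) (hΔ : ∀ x, 0 ≤ -(Δ f) x) (x₀ : 𝔼) : -(Δ f) x₀ = 0 := by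
  by_contra hne
  set g : 𝔼 → ℝ := fun x => f (x₀ + (1 : ℝ) • x) with hg
  have hgC : ContDiff ℝ 2 g := hf.comp (by fun_prop)
  have hgΔ : ∀ x, -(Δ g) x = -(Δ f) (x₀ + (1 : ℝ) • x) := fun x => by
    rw [hg, laplacian_comp_const_smul hf]; ring
  have cΔ : Continuous fun x => -(Δ g) x := (continuous_laplacian hgC).neg
  have hg0 : ∀ x, 0 ≤ -(Δ g) x := fun x => by rw [hgΔ]; exact hΔ _
  have hm0 : ∀ x : 𝔼, 0 ≤ -(Δ g) x * meanPotential x := fun x =>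
    mul_nonneg (hg0 x) (meanPotential_nonneg x)
  have hc : 0 < ∫ x, -(Δ g) x * meanPotential x := by
    refine (cΔ.mul
      contDiff_meanPotential.continuous).integral_pos_of_hasCompactSupport_nonneg_nonzero
      hasCompactSupport_meanPotential.mul_left hm0 (x := 0) ?_
    refine mul_ne_zero ?_ meanPotential_zero_ne
    rw [hgΔ]
    simpa using hne
  refine not_pos_of_mean_laplacian_le hgC (fun x => hpos _) hc fun t ht => ?_
  have ht0 : 0 < t := by linarith
  have e := Measure.integral_comp_smul (volume : Measure 𝔼)
    (fun y => -(Δ g) y * meanPotential (t⁻¹ • y)) t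
  simp only [smul_smul, inv_mul_cancel₀ ht0.ne', one_smul, finrank_euclideanSpace,
    Fintype.card_fin] at e
  rw [e, smul_eq_mul, abs_of_pos (by positivity), div_eq_inv_mul]
  have cs : HasCompactSupport fun y : 𝔼 => meanPotential (t⁻¹ • y) :=
    hasCompactSupport_meanPotential.comp_smul (inv_ne_zero ht0.ne')
  refine mul_le_mul ?_ ?_ hc.le (by positivity)
  · gcongr
  · refine integral_mono
      ((cΔ.mul contDiff_meanPotential.continuous).integrable_of_hasCompactSupport
        hasCompactSupport_meanPotential.mul_left)
      ((cΔ.mul (contDiff_meanPotential.continuous.comp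
        (continuous_const_smul _))).integrable_of_hasCompactSupport cs.mul_left) fun y => ?_
    refine mul_le_mul_of_nonneg_left ?_ (hg0 y)
    unfold meanPotential meanKernel
    have : ‖t⁻¹ • y‖ ≤ ‖y‖ := by
      rw [norm_smul, Real.norm_of_nonneg (by positivity)]
      exact mul_le_of_le_one_left (norm_nonneg _) (inv_le_one_of_one_le₀ ht)
    gcongr

theorem continuous_norm_rpow {a : ℝ} (ha : 0 ≤ a) : Continuous fun x : 𝔼 => ‖x‖ ^ a :=
  continuous_norm.rpow_const fun _ => .inr ha

/-- The means of `v` over large balls tend to zero: otherwise `v` would be bounded below by the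
weak Harnack inequality, and `-Δ u = |x|^a v^p` would force `u` to become negative. -/
theorem exists_weightedMean_lt {u v : 𝔼 → ℝ} {a p : ℝ} (hN : N ≠ 0) (ha : 0 ≤ a) (hp : 0 ≤ p)
    (hu : ContDiff ℝ 2 u) (hv : ContDiff ℝ 2 v) (hupos : ∀ x, 0 < u x) (hvpos : ∀ x, 0 < v x)
    (hvΔ : ∀ x, 0 ≤ -(Δ v) x) (heq : ∀ x, -(Δ u) x = ‖x‖ ^ a * v x ^ p) (x₀ : 𝔼) {ε : ℝ}
    (hε : 0 < ε) : ∃ t : ℝ, 0 ≤ t ∧ weightedMean v x₀ t < ε := by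
  by_contra! hcon
  obtain ⟨m, hm, hvm⟩ : ∃ m : ℝ, 0 < m ∧ ∀ y, m ≤ v y := by
    refine ⟨ε / (2 ^ (N + 2) * ∫ z : 𝔼, meanKernel z), by
      have := integral_meanKernel_pos (N := N); positivity, fun y => ?_⟩
    have hI := integral_meanKernel_pos (N := N)
    have h1 := weightedMean_le_mul_of_superharmonic hv hvpos hvΔ x₀ y (t := 2 * ‖x₀ - y‖ + 1)
      (by positivity) (by linarith)
    have h2 := hcon (2 * ‖x₀ - y‖ + 1) (by positivity)
    rw [div_le_iff₀ (by positivity)]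
    linarith
  set I : ℝ := ∫ y : 𝔼, ‖y‖ ^ a * meanPotential y with hI
  have cI : Continuous fun y : 𝔼 => ‖y‖ ^ a * meanPotential y :=
    (continuous_norm_rpow ha).mul contDiff_meanPotential.continuous
  have hIpos : 0 < I := by
    have : Nonempty (Fin N) := ⟨⟨0, Nat.pos_of_ne_zero hN⟩⟩
    obtain ⟨y, hy⟩ : ∃ y : 𝔼, ‖y‖ = 2⁻¹ := by
      obtain ⟨y, hy⟩ := exists_norm_eq 𝔼 (c := 2⁻¹) (by norm_num)
      exact ⟨y, hy⟩
    refine cI.integral_pos_of_hasCompactSupport_nonneg_nonzero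
      hasCompactSupport_meanPotential.mul_left
      (fun y => mul_nonneg (by positivity) (meanPotential_nonneg y)) (x := y) ?_
    refine mul_ne_zero (Real.rpow_pos_of_pos (by rw [hy]; norm_num) a).ne' ?_
    unfold meanPotential meanKernel
    rw [hy]
    norm_num
  refine not_pos_of_mean_laplacian_le hu hupos (c := m ^ p * I) (by positivity) fun t ht => ?_
  have ht0 : 0 < t := by linarith
  calc m ^ p * I / t ^ 2 ≤ m ^ p * I :=
        div_le_self (by positivity) (one_le_pow₀ ht)
    _ = ∫ y : 𝔼, m ^ p * (‖y‖ ^ a * meanPotential y) := by rw [integral_const_mul]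
    _ ≤ _ := by
        refine integral_mono ((cI.integrable_of_hasCompactSupport
            hasCompactSupport_meanPotential.mul_left).const_mul _)
          ((((continuous_laplacian hu).comp (continuous_const_smul t)).neg.mul
            contDiff_meanPotential.continuous).integrable_of_hasCompactSupport
            hasCompactSupport_meanPotential.mul_left) fun y => ?_
        simp only
        rw [heq, ← mul_assoc, mul_comm (m ^ p)]
        refine mul_le_mul_of_nonneg_right ?_ (meanPotential_nonneg y)
        refine mul_le_mul ?_ (Real.rpow_le_rpow hm.le (hvm _) hp) (by positivity) (by positivity)
        refine Real.rpow_le_rpow (norm_nonneg _) ?_ ha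
        rw [norm_smul, Real.norm_of_nonneg ht0.le]
        exact le_mul_of_one_le_left (norm_nonneg _) ht

/-- A convex `C²` substitute for the positive part, below it: `s³ / (1 + s)²` for `s ≥ 0`. -/
noncomputable def smoothPosPart (s : ℝ) : ℝ := if 0 ≤ s then s ^ 3 / (1 + s) ^ 2 else 0

/-- The derivative of `smoothPosPart`. -/
noncomputable def smoothPosPartDeriv (s : ℝ) : ℝ :=
  if 0 ≤ s then s ^ 2 * (s + 3) / (1 + s) ^ 3 else 0

/-- The second derivative of `smoothPosPart`. -/
noncomputable def smoothPosPartDerivTwo (s : ℝ) : ℝ := if 0 ≤ s then 6 * s / (1 + s) ^ 4 else 0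

theorem hasDerivAt_smoothPosPart (s : ℝ) :
    HasDerivAt smoothPosPart (smoothPosPartDeriv s) s := by
  refine hasDerivAt_extend_zero (f := fun s => s ^ 3 / (1 + s) ^ 2)
    (f' := fun s => s ^ 2 * (s + 3) / (1 + s) ^ 3) (fun s hs => ?_) (by simp) (by simp) s
  have h1 : 1 + s ≠ 0 := by positivity
  have := (hasDerivAt_pow 3 s).div (((hasDerivAt_id s).const_add 1).pow 2) (by simpa using h1)
  refine this.congr_deriv ?_
  simp
  field_simp
  ring

theorem hasDerivAt_smoothPosPartDeriv (s : ℝ) :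
    HasDerivAt smoothPosPartDeriv (smoothPosPartDerivTwo s) s := by
  refine hasDerivAt_extend_zero (f := fun s => s ^ 2 * (s + 3) / (1 + s) ^ 3)
    (f' := fun s => 6 * s / (1 + s) ^ 4) (fun s hs => ?_) (by simp) (by simp) s
  have h1 : 1 + s ≠ 0 := by positivity
  have := ((hasDerivAt_pow 2 s).mul ((hasDerivAt_id s).add_const 3)).div
    (((hasDerivAt_id s).const_add 1).pow 3) (by simpa using h1)
  refine this.congr_deriv ?_
  simp
  field_simp
  ring

theorem contDiff_smoothPosPart : ContDiff ℝ 2 smoothPosPart := by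
  have h2 : Continuous smoothPosPartDerivTwo := by
    refine continuous_if_le continuous_const continuous_id ?_ continuous_const.continuousOn ?_
    · refine ContinuousOn.div (by fun_prop) (by fun_prop) fun s hs => ?_
      have : (0 : ℝ) ≤ s := hs
      positivity
    · intro s hs
      rw [← hs]; simp
  rw [show (2 : WithTop ℕ∞) = 1 + 1 from by norm_num, contDiff_succ_iff_deriv]
  refine ⟨fun s => (hasDerivAt_smoothPosPart s).differentiableAt, by simp, ?_⟩
  rw [show deriv smoothPosPart = smoothPosPartDeriv from
    funext fun s => (hasDerivAt_smoothPosPart s).deriv, contDiff_one_iff_deriv]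
  refine ⟨fun s => (hasDerivAt_smoothPosPartDeriv s).differentiableAt, ?_⟩
  rwa [show deriv smoothPosPartDeriv = smoothPosPartDerivTwo from
    funext fun s => (hasDerivAt_smoothPosPartDeriv s).deriv]

theorem laplacian_smoothPosPart_comp_nonneg {w : 𝔼 → ℝ} {x : 𝔼} (hw : ContDiffAt ℝ 2 w x)
    (h : 0 < w x → 0 ≤ (Δ w) x) : 0 ≤ (Δ (fun y => smoothPosPart (w y))) x := by
  rw [laplacian_comp hw contDiff_smoothPosPart.contDiffAt
    (.of_forall fun s => hasDerivAt_smoothPosPart s) (hasDerivAt_smoothPosPartDeriv _)]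
  rcases le_or_gt (w x) 0 with hx | hx
  · rcases eq_or_lt_of_le hx with hx | hx
    · simp [smoothPosPartDeriv, smoothPosPartDerivTwo, hx]
    · simp [smoothPosPartDeriv, smoothPosPartDerivTwo, hx.not_ge]
  · have := h hx
    simp only [smoothPosPartDeriv, smoothPosPartDerivTwo, if_pos hx.le]
    positivity

theorem smoothPosPart_of_nonpos {s : ℝ} (hs : s ≤ 0) : smoothPosPart s = 0 := by
  rcases eq_or_lt_of_le hs with rfl | hs
  · simp [smoothPosPart]
  · simp [smoothPosPart, hs.not_ge]

theorem smoothPosPart_pos {s : ℝ} (hs : 0 < s) : 0 < smoothPosPart s := by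
  simp only [smoothPosPart, if_pos hs.le]
  positivity

theorem smoothPosPart_le {s y : ℝ} (hs : s ≤ y) (hy : 0 ≤ y) : smoothPosPart s ≤ y := by
  rcases le_or_gt s 0 with h | h
  · rwa [smoothPosPart_of_nonpos h]
  · simp only [smoothPosPart, if_pos h.le]
    refine le_trans ?_ hs
    rw [div_le_iff₀ (by positivity)]
    nlinarith [sq_nonneg s]

/-! ### Laplacians of logarithms and exponentials -/

theorem gradient_log {f : 𝔼 → ℝ} {x : 𝔼} (hf : DifferentiableAt ℝ f x) (hx : f x ≠ 0) :
    ∇ (fun y => Real.log (f y)) x = (f x)⁻¹ • ∇ f x :=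
  gradient_comp' (Real.hasDerivAt_log hx) hf

theorem laplacian_log {f : 𝔼 → ℝ} {x : 𝔼} (hf : ContDiffAt ℝ 2 f x) (hx : f x ≠ 0) :
    (Δ (fun y => Real.log (f y))) x = (Δ f) x / f x - ‖∇ (fun y => Real.log (f y)) x‖ ^ 2 := by
  have h0 : ∀ᶠ s in 𝓝 (f x), HasDerivAt Real.log s⁻¹ s :=
    (eventually_ne_nhds hx).mono fun s hs => Real.hasDerivAt_log hs
  rw [laplacian_comp hf (Real.contDiffAt_log.2 hx) h0 (hasDerivAt_inv hx),
    gradient_log (hf.differentiableAt (by norm_num)) hx, norm_smul, mul_pow, norm_inv,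
    Real.norm_eq_abs, inv_pow, sq_abs]
  ring

theorem laplacian_exp {f : 𝔼 → ℝ} {x : 𝔼} (hf : ContDiffAt ℝ 2 f x) :
    (Δ (fun y => Real.exp (f y))) x = Real.exp (f x) * ((Δ f) x + ‖∇ f x‖ ^ 2) := by
  rw [laplacian_comp hf Real.contDiff_exp.contDiffAt (.of_forall Real.hasDerivAt_exp)
    (Real.hasDerivAt_exp _)]
  ring

theorem laplacian_norm_sq (x : 𝔼) : (Δ (fun y : 𝔼 => ‖y‖ ^ 2)) x = (2 * N : ℝ) := by
  rw [laplacian_eq_sum (contDiff_norm_sq ℝ).contDiffAt]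
  have h : ∀ i : Fin N, (fun y : 𝔼 => fderiv ℝ (fun y : 𝔼 => ‖y‖ ^ 2) y
      (EuclideanSpace.basisFun (Fin N) ℝ i)) =
      fun y => (2 : ℝ) * innerSL ℝ (EuclideanSpace.basisFun (Fin N) ℝ i) y := by
    intro i
    funext y
    rw [← inner_gradient_left, gradient_norm_sq, inner_smul_left, real_inner_comm]
    simp
  simp_rw [h]
  have h2 : ∀ i : Fin N, fderiv ℝ (fun y : 𝔼 => (2 : ℝ) *
      innerSL ℝ (EuclideanSpace.basisFun (Fin N) ℝ i) y) x
      (EuclideanSpace.basisFun (Fin N) ℝ i) = 2 := by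
    intro i
    rw [fderiv_const_mul (ContinuousLinearMap.differentiableAt _), ContinuousLinearMap.fderiv]
    simp
  simp_rw [h2]
  simp
  ring

theorem contDiffAt_log_add_norm_sq {ε : ℝ} {x : 𝔼} (hx : ε + ‖x‖ ^ 2 ≠ 0) :
    ContDiffAt ℝ 2 (fun y : 𝔼 => Real.log (ε + ‖y‖ ^ 2)) x :=
  (contDiff_const.add (contDiff_norm_sq ℝ)).contDiffAt.log hx

theorem gradient_log_add_norm_sq {ε : ℝ} {x : 𝔼} (hx : ε + ‖x‖ ^ 2 ≠ 0) :
    ∇ (fun y : 𝔼 => Real.log (ε + ‖y‖ ^ 2)) x = (2 / (ε + ‖x‖ ^ 2)) • x := by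
  have hd : DifferentiableAt ℝ (fun y : 𝔼 => ‖y‖ ^ 2) x :=
    (contDiff_norm_sq (n := 1) ℝ).differentiable (by norm_num) x
  rw [gradient_log (f := fun y : 𝔼 => ε + ‖y‖ ^ 2) (hd.const_add ε) hx,
    gradient_add' (differentiableAt_const ε) hd, gradient_norm_sq, gradient_fun_const, zero_add,
    smul_smul]
  congr 1
  ring

theorem laplacian_log_add_norm_sq {ε : ℝ} {x : 𝔼} (hx : ε + ‖x‖ ^ 2 ≠ 0) :
    (Δ (fun y : 𝔼 => Real.log (ε + ‖y‖ ^ 2))) x =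
      2 * N / (ε + ‖x‖ ^ 2) - 4 * ‖x‖ ^ 2 / (ε + ‖x‖ ^ 2) ^ 2 := by
  have hC : ContDiffAt ℝ 2 (fun y : 𝔼 => ‖y‖ ^ 2) x := (contDiff_norm_sq ℝ).contDiffAt
  rw [laplacian_log (f := fun y : 𝔼 => ε + ‖y‖ ^ 2) (contDiffAt_const.add hC) hx,
    gradient_log_add_norm_sq hx]
  have : (Δ (fun y : 𝔼 => ε + ‖y‖ ^ 2)) x = (2 * N : ℝ) := by
    have := ContDiffAt.laplacian_add (f₁ := fun _ : 𝔼 => ε) contDiffAt_const hC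
    rw [show (fun _ : 𝔼 => ε) + (fun y : 𝔼 => ‖y‖ ^ 2) = fun y : 𝔼 => ε + ‖y‖ ^ 2 from rfl] at this
    rw [this, laplacian_norm_sq]
    simp
  rw [this, norm_smul, mul_pow, Real.norm_eq_abs, sq_abs, div_pow]
  ring

theorem laplacian_const_mul' {f : 𝔼 → ℝ} {x : 𝔼} (c : ℝ) (hf : ContDiffAt ℝ 2 f x) :
    (Δ (fun y => c * f y)) x = c * (Δ f) x :=
  InnerProductSpace.laplacian_smul c hf

theorem laplacian_add' {f g : 𝔼 → ℝ} {x : 𝔼} (hf : ContDiffAt ℝ 2 f x)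
    (hg : ContDiffAt ℝ 2 g x) : (Δ (fun y => f y + g y)) x = (Δ f) x + (Δ g) x :=
  hf.laplacian_add hg

/-! ### The comparison property -/

/-- The logarithm of the comparison function `c |x|^{-s} u^σ`. -/
noncomputable def logBarrier (u : 𝔼 → ℝ) (σ s c : ℝ) (y : 𝔼) : ℝ :=
  σ * Real.log (u y) + (-(s / 2) * Real.log (0 + ‖y‖ ^ 2) + c)

theorem logBarrier_of_zero (u : 𝔼 → ℝ) (σ c : ℝ) :
    logBarrier u σ 0 c = fun y => σ * Real.log (u y) + c := by
  funext y; simp [logBarrier]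

theorem contDiffAt_logBarrier {u : 𝔼 → ℝ} (hu : ContDiff ℝ 2 u) (hpos : ∀ x, 0 < u x)
    {σ s c : ℝ} {x : 𝔼} (hx : x ≠ 0 ∨ s = 0) : ContDiffAt ℝ 2 (logBarrier u σ s c) x := by
  have h1 : ContDiffAt ℝ 2 (fun y => σ * Real.log (u y)) x :=
    contDiffAt_const.mul (hu.contDiffAt.log (hpos x).ne')
  rcases hx with hx | rfl
  · refine h1.add ((contDiffAt_const.mul (contDiffAt_log_add_norm_sq ?_)).add contDiffAt_const)
    have := norm_pos_iff.2 hx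
    positivity
  · rw [logBarrier_of_zero]
    exact h1.add contDiffAt_const

/-- Superharmonicity of `|x|^{-s} u^σ`: for `s ≤ (1 - σ) (N - 2)` it is a geometric mean of the
superharmonic functions `u` and `|x|^{-s/(1-σ)}`. -/
theorem laplacian_exp_logBarrier_le {u : 𝔼 → ℝ} (hu : ContDiff ℝ 2 u) (hpos : ∀ x, 0 < u x)
    {σ s c : ℝ} (hσ : 0 ≤ σ) (hσ1 : σ ≤ 1) (hs : 0 ≤ s) (hs1 : s ≤ (1 - σ) * ((N : ℝ) - 2))
    {x : 𝔼} (hx : x ≠ 0 ∨ s = 0) :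
    (Δ (fun y => Real.exp (logBarrier u σ s c y))) x ≤
      σ * Real.exp (logBarrier u σ s c x) * ((Δ u) x / u x) := by
  rw [laplacian_exp (contDiffAt_logBarrier hu hpos hx), mul_right_comm σ, mul_comm _ (Real.exp _)]
  refine mul_le_mul_of_nonneg_left ?_ (Real.exp_pos _).le
  have hl : ContDiffAt ℝ 2 (fun y => Real.log (u y)) x := hu.contDiffAt.log (hpos x).ne'
  have hl1 : ContDiffAt ℝ 2 (fun y => σ * Real.log (u y)) x := contDiffAt_const.mul hl
  have e1 := laplacian_log hu.contDiffAt (hpos x).ne'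
  have two : (2 : WithTop ℕ∞) ≠ 0 := by norm_num
  set A := ∇ (fun y => Real.log (u y)) x with hA
  rcases hx with hx | rfl
  · have hr : 0 < ‖x‖ := norm_pos_iff.2 hx
    have hr0 : 0 + ‖x‖ ^ 2 ≠ 0 := by positivity
    have hn := contDiffAt_log_add_norm_sq hr0
    have hn1 : ContDiffAt ℝ 2 (fun y : 𝔼 => -(s / 2) * Real.log (0 + ‖y‖ ^ 2)) x :=
      contDiffAt_const.mul hn
    have hn2 : ContDiffAt ℝ 2 (fun y : 𝔼 => -(s / 2) * Real.log (0 + ‖y‖ ^ 2) + c) x :=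
      hn1.add contDiffAt_const
    have eL : (Δ (logBarrier u σ s c)) x = σ * ((Δ u) x / u x - ‖A‖ ^ 2) -
        s * ((N : ℝ) - 2) / ‖x‖ ^ 2 := by
      unfold logBarrier
      rw [laplacian_add' hl1 hn2, laplacian_add' hn1 contDiffAt_const, laplacian_const_mul' _ hl,
        laplacian_const_mul' _ hn, e1, laplacian_log_add_norm_sq hr0,
        InnerProductSpace.laplacian_const]
      simp only [zero_add, Pi.zero_apply]
      field_simp
      ring
    have eG : ∇ (logBarrier u σ s c) x = σ • A - (s / ‖x‖ ^ 2) • x := by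
      unfold logBarrier
      rw [gradient_add' (hl1.differentiableAt two) (hn2.differentiableAt two),
        gradient_add' (hn1.differentiableAt two) (differentiableAt_const c),
        gradient_const_mul' _ (hl.differentiableAt two),
        gradient_const_mul' _ (hn.differentiableAt two), gradient_log_add_norm_sq hr0,
        gradient_fun_const, smul_smul, add_zero, sub_eq_add_neg, ← neg_smul]
      congr 2
      simp only [zero_add]
      ring
    rw [eL, eG, norm_sub_sq_real, norm_smul, norm_smul, inner_smul_left, inner_smul_right]
    simp only [mul_pow, Real.norm_eq_abs, sq_abs, conj_trivial]
    set X := ⟪A, x⟫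
    set r := ‖x‖
    rcases eq_or_lt_of_le hσ1 with rfl | hσ1
    · have : s = 0 := by nlinarith
      subst this
      simp
    · have h1 : 0 ≤ ‖(1 - σ) • A + (s / r ^ 2) • x‖ ^ 2 := by positivity
      rw [norm_add_sq_real, norm_smul, norm_smul, inner_smul_left, inner_smul_right] at h1
      simp only [mul_pow, Real.norm_eq_abs, sq_abs, conj_trivial] at h1
      have h2 : (s / r ^ 2) ^ 2 * r ^ 2 = s ^ 2 / r ^ 2 := by field_simp
      rw [h2] at h1 ⊢
      have h3 : 0 ≤ s * ((1 - σ) * ((N : ℝ) - 2) - s) / r ^ 2 := by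
        have : 0 ≤ (1 - σ) * ((N : ℝ) - 2) - s := by linarith
        positivity
      have h4 : 0 < 1 - σ := by linarith
      have h5 := mul_nonneg hσ h1
      have key : 0 ≤ (1 - σ) * (σ * (1 - σ) * ‖A‖ ^ 2 + 2 * (σ * (s / r ^ 2 * X)) +
          s * ((N : ℝ) - 2) / r ^ 2 - s ^ 2 / r ^ 2) := by
        have : (1 - σ) * (σ * (1 - σ) * ‖A‖ ^ 2 + 2 * (σ * (s / r ^ 2 * X)) +
          s * ((N : ℝ) - 2) / r ^ 2 - s ^ 2 / r ^ 2) =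
          σ * ((1 - σ) ^ 2 * ‖A‖ ^ 2 + 2 * ((1 - σ) * (s / r ^ 2 * X)) + s ^ 2 / r ^ 2) +
          s * ((1 - σ) * ((N : ℝ) - 2) - s) / r ^ 2 := by ring
        rw [this]
        exact add_nonneg h5 h3
      have := nonneg_of_mul_nonneg_right key h4
      linarith
  · rw [logBarrier_of_zero]
    have eL : (Δ (fun y => σ * Real.log (u y) + c)) x = σ * ((Δ u) x / u x - ‖A‖ ^ 2) := by
      rw [laplacian_add' hl1 contDiffAt_const, laplacian_const_mul' _ hl, e1,
        InnerProductSpace.laplacian_const]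
      simp
    have eG : ∇ (fun y => σ * Real.log (u y) + c) x = σ • A := by
      rw [gradient_add' (hl1.differentiableAt two) (differentiableAt_const c),
        gradient_const_mul' _ (hl.differentiableAt two), gradient_fun_const, add_zero]
    rw [eL, eG, norm_smul, mul_pow, Real.norm_eq_abs, sq_abs]
    have : σ ^ 2 * ‖A‖ ^ 2 ≤ σ * ‖A‖ ^ 2 := by
      gcongr
      nlinarith
    linarith

theorem tendsto_exp_logBarrier {u : 𝔼 → ℝ} (hu : ContDiff ℝ 2 u) (hpos : ∀ x, 0 < u x)
    {σ s c : ℝ} (hs : 0 < s) :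
    Tendsto (fun y => Real.exp (logBarrier u σ s c y)) (𝓝[≠] 0) atTop := by
  refine Real.tendsto_exp_atTop.comp ?_
  have h1 : Tendsto (fun y => σ * Real.log (u y)) (𝓝[≠] 0) (𝓝 (σ * Real.log (u 0))) :=
    ((hu.continuous.log fun x => (hpos x).ne').const_mul σ).continuousAt.mono_left
      nhdsWithin_le_nhds
  refine h1.add_atTop (tendsto_atTop_add_const_right _ c ?_)
  have h2 : Tendsto (fun y : 𝔼 => 0 + ‖y‖ ^ 2) (𝓝[≠] 0) (𝓝[≠] 0) := by
    refine tendsto_nhdsWithin_iff.2 ⟨?_, ?_⟩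
    · have : ContinuousAt (fun y : 𝔼 => 0 + ‖y‖ ^ 2) 0 := by fun_prop
      have := this.tendsto.mono_left (nhdsWithin_le_nhds (s := {0}ᶜ))
      simpa using this
    · filter_upwards [self_mem_nhdsWithin] with y hy
      have := norm_pos_iff.2 hy
      simp only [Set.mem_compl_iff, Set.mem_singleton_iff]
      positivity
  exact (Real.tendsto_log_nhdsNE_zero.comp h2).const_mul_atBot_of_neg (by linarith)

theorem norm_rpow_mul_exp_logBarrier {p q a b : ℝ} (hp : 0 < p) (hq : 0 < q) {u : 𝔼 → ℝ}
    (hpos : ∀ x, 0 < u x) {x : 𝔼} (hx : x ≠ 0 ∨ (a - b) / (p + 1) = 0) :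
    (q + 1) / (p + 1) * (‖x‖ ^ a * Real.exp (logBarrier u ((q + 1) / (p + 1)) ((a - b) / (p + 1))
      (Real.log ((p + 1) / (q + 1)) / (p + 1)) x) ^ (p + 1)) = ‖x‖ ^ b * u x ^ (q + 1) := by
  have hp1 : p + 1 ≠ 0 := by positivity
  have hk : 0 < (p + 1) / (q + 1) := by positivity
  have e : Real.exp (logBarrier u ((q + 1) / (p + 1)) ((a - b) / (p + 1))
      (Real.log ((p + 1) / (q + 1)) / (p + 1)) x) ^ (p + 1) =
      u x ^ (q + 1) * (Real.exp (-((a - b) / 2) * Real.log (0 + ‖x‖ ^ 2)) *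
        ((p + 1) / (q + 1))) := by
    rw [← Real.exp_mul, Real.rpow_def_of_pos (hpos x)]
    conv_rhs => rw [← Real.exp_log hk]
    rw [← Real.exp_add, ← Real.exp_add]
    congr 1
    unfold logBarrier
    field_simp
  rw [e]
  have hσ : (q + 1) / (p + 1) * ((p + 1) / (q + 1)) = 1 := by field_simp
  have main : ‖x‖ ^ a * Real.exp (-((a - b) / 2) * Real.log (0 + ‖x‖ ^ 2)) = ‖x‖ ^ b := by
    rcases eq_or_ne x 0 with rfl | hx0
    · have : a = b := by
        rcases hx with h | h
        · exact absurd rfl h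
        · rcases div_eq_zero_iff.1 h with h | h
          · linarith
          · exact absurd h hp1
      simp [this]
    · have hr : 0 < ‖x‖ := norm_pos_iff.2 hx0
      rw [Real.rpow_def_of_pos hr, Real.rpow_def_of_pos hr, ← Real.exp_add, zero_add, Real.log_pow]
      congr 1
      push_cast
      ring
  calc _ = (q + 1) / (p + 1) * ((p + 1) / (q + 1)) * (‖x‖ ^ a *
        Real.exp (-((a - b) / 2) * Real.log (0 + ‖x‖ ^ 2))) * u x ^ (q + 1) := by ring
    _ = _ := by rw [hσ, main, one_mul]

/-- The comparison property `|x|^a v^{p+1} / (p+1) ≤ |x|^b u^{q+1} / (q+1)`: the positive part of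
`v - c |x|^{-s} u^σ`, or rather its smooth substitute, is subharmonic and below `v`, whose means
over large balls tend to zero. -/
theorem comparison {p q a b : ℝ} {u v : 𝔼 → ℝ} (h : IsPositiveSolution N p q a b u v)
    (hN : N ≠ 0) (hp : 0 < p) (hq : 0 < q) (hqp : q ≤ p) (hb : 0 ≤ b) (hab : 0 ≤ a - b)
    (hab' : a - b ≤ ((N : ℝ) - 2) * (p - q)) (x : 𝔼) :
    (q + 1) * (‖x‖ ^ a * v x ^ (p + 1)) ≤ (p + 1) * (‖x‖ ^ b * u x ^ (q + 1)) := by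
  have ha : 0 ≤ a := by linarith
  set σ := (q + 1) / (p + 1) with hσ
  set s := (a - b) / (p + 1) with hs
  set c := Real.log ((p + 1) / (q + 1)) / (p + 1) with hc
  have hp1 : 0 < p + 1 := by linarith
  have hσ0 : 0 < σ := by positivity
  have hσ1 : σ ≤ 1 := by rw [hσ, div_le_one hp1]; linarith
  have hs0 : 0 ≤ s := by positivity
  have hs1 : s ≤ (1 - σ) * ((N : ℝ) - 2) := by
    have : (1 - σ) * ((N : ℝ) - 2) = ((N : ℝ) - 2) * (p - q) / (p + 1) := by
      rw [hσ]; field_simp; ring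
    rw [this, hs]
    gcongr
  set w : 𝔼 → ℝ := fun y => v y - Real.exp (logBarrier u σ s c y) with hw
  have hvΔ : ∀ y, 0 ≤ -(Δ v) y := fun y => by
    rw [h.eq_v]; exact mul_nonneg (by positivity) (Real.rpow_nonneg (h.u_pos y).le _)
  have hzC : ∀ y : 𝔼, (y ≠ 0 ∨ s = 0) →
      ContDiffAt ℝ 2 (fun y => Real.exp (logBarrier u σ s c y)) y := fun y hy =>
    (contDiffAt_logBarrier h.contDiff_u h.u_pos hy).exp
  have hwC : ∀ y : 𝔼, (y ≠ 0 ∨ s = 0) → ContDiffAt ℝ 2 w y := fun y hy =>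
    h.contDiff_v.contDiffAt.sub (hzC y hy)
  have hwΔ : ∀ y : 𝔼, (y ≠ 0 ∨ s = 0) → 0 < w y → 0 ≤ (Δ w) y := by
    intro y hy hwy
    set z := Real.exp (logBarrier u σ s c y) with hz
    have hz0 : 0 < z := Real.exp_pos _
    have e1 : (Δ w) y = (Δ v) y - (Δ (fun y => Real.exp (logBarrier u σ s c y))) y :=
      h.contDiff_v.contDiffAt.laplacian_sub (hzC y hy)
    have e2 := laplacian_exp_logBarrier_le h.contDiff_u h.u_pos (c := c) hσ0.le hσ1 hs0 hs1 hy
    have e3 := h.eq_u y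
    have e4 := h.eq_v y
    have e5 := norm_rpow_mul_exp_logBarrier hp hq h.u_pos (a := a) (b := b) hy
    rw [← hσ, ← hs, ← hc, ← hz] at e5
    have hup := h.u_pos y
    have hzv : z ≤ v y := (sub_pos.1 hwy).le
    have e6 : z ^ p ≤ v y ^ p := Real.rpow_le_rpow hz0.le hzv hp.le
    have e7 : ‖y‖ ^ b * u y ^ q ≤ σ * z * (‖y‖ ^ a * v y ^ p / u y) := by
      have : ‖y‖ ^ b * u y ^ q = σ * z * (‖y‖ ^ a * z ^ p / u y) := by
        rw [Real.rpow_add_one hz0.ne', Real.rpow_add_one hup.ne'] at e5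
        field_simp
        linarith
      rw [this]
      gcongr
    have e8 : (Δ u) y / u y = -(‖y‖ ^ a * v y ^ p / u y) := by
      rw [← e3]; ring
    rw [e8] at e2
    linarith
  -- For `s > 0` the barrier tends to infinity at the origin, where the Lean value of `w` is
  -- meaningless; the substitute for the positive part of `w` extends by zero there.
  set f : 𝔼 → ℝ := fun y => if y = 0 ∧ s ≠ 0 then 0 else smoothPosPart (w y) with hf
  have hloc : ∀ y : 𝔼, (y ≠ 0 ∨ s = 0) → f =ᶠ[𝓝 y] fun y => smoothPosPart (w y) := by
    intro y hy
    rcases hy with hy | hy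
    · filter_upwards [eventually_ne_nhds hy] with z hz
      simp [hf, hz]
    · exact .of_forall fun z => by simp [hf, hy]
  have hloc0 : s ≠ 0 → f =ᶠ[𝓝 0] fun _ => 0 := by
    intro hs
    have ht := tendsto_exp_logBarrier h.contDiff_u h.u_pos (σ := σ) (c := c)
      (lt_of_le_of_ne hs0 (Ne.symm hs))
    have h1 : ∀ᶠ y in 𝓝[≠] (0 : 𝔼), v y < v 0 + 1 :=
      nhdsWithin_le_nhds (h.contDiff_v.continuous.continuousAt.eventually_lt_const (by linarith))
    have h2 : ∀ᶠ y in 𝓝[≠] (0 : 𝔼), f y = 0 := by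
      filter_upwards [h1, ht.eventually_ge_atTop (v 0 + 1)] with y hy1 hy2
      simp only [hf]
      split_ifs
      · rfl
      · exact smoothPosPart_of_nonpos (by simp only [hw]; linarith)
    rw [eventually_nhdsWithin_iff] at h2
    filter_upwards [h2] with y hy
    by_cases hy0 : y = 0
    · simp [hf, hy0, hs]
    · exact hy hy0
  have hfC : ContDiff ℝ 2 f := by
    rw [contDiff_iff_contDiffAt]
    intro y
    by_cases hy : y ≠ 0 ∨ s = 0
    · exact (contDiff_smoothPosPart.contDiffAt.comp y (hwC y hy)).congr_of_eventuallyEq (hloc y hy)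
    · push Not at hy
      rw [hy.1]
      exact contDiffAt_const.congr_of_eventuallyEq (hloc0 hy.2)
  have hfΔ : ∀ y, 0 ≤ (Δ f) y := by
    intro y
    by_cases hy : y ≠ 0 ∨ s = 0
    · rw [(InnerProductSpace.laplacian_congr_nhds (hloc y hy)).eq_of_nhds]
      exact laplacian_smoothPosPart_comp_nonneg (hwC y hy) (hwΔ y hy)
    · push Not at hy
      rw [hy.1, (InnerProductSpace.laplacian_congr_nhds (hloc0 hy.2)).eq_of_nhds,
        InnerProductSpace.laplacian_const]
      simp
  have hfv : ∀ y, f y ≤ v y := by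
    intro y
    simp only [hf]
    split_ifs
    · exact (h.v_pos y).le
    · exact smoothPosPart_le (by simp only [hw]; linarith [Real.exp_pos (logBarrier u σ s c y)])
        (h.v_pos y).le
  have hf0 : ∀ y, f y ≤ 0 := by
    intro y
    by_contra! hy
    have hI := integral_meanKernel_pos (N := N)
    obtain ⟨t, ht, htv⟩ := exists_weightedMean_lt hN ha hp.le h.contDiff_u h.contDiff_v h.u_pos
      h.v_pos hvΔ h.eq_u y (mul_pos hy hI)
    have h1 := le_weightedMean_of_subharmonic hfC hfΔ y ht
    have h2 : weightedMean f y t ≤ weightedMean v y t := by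
      refine integral_mono ?_ ?_ fun z =>
        mul_le_mul_of_nonneg_right (hfv _) (meanKernel_nonneg z)
      · exact (Continuous.mul (hfC.continuous.comp (by fun_prop))
          continuous_meanKernel).integrable_of_hasCompactSupport
          hasCompactSupport_meanKernel.mul_left
      · exact (Continuous.mul (h.contDiff_v.continuous.comp (by fun_prop))
          continuous_meanKernel).integrable_of_hasCompactSupport
          hasCompactSupport_meanKernel.mul_left
    linarith
  by_cases hx : x ≠ 0 ∨ s = 0
  · have hx' : ¬(x = 0 ∧ s ≠ 0) := by tauto
    have h1 := hf0 x
    simp only [hf, if_neg hx'] at h1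
    have h2 : w x ≤ 0 := by
      by_contra! h3
      exact (smoothPosPart_pos h3).not_ge h1
    have h3 : v x ≤ Real.exp (logBarrier u σ s c x) := sub_nonpos.1 h2
    have h4 := Real.rpow_le_rpow (h.v_pos x).le h3 hp1.le
    have h5 := norm_rpow_mul_exp_logBarrier hp hq h.u_pos (a := a) (b := b) hx
    rw [← hσ, ← hs, ← hc] at h5
    rw [← h5, hσ, ← mul_assoc (p + 1), mul_div_cancel₀ _ hp1.ne']
    gcongr
  · push Not at hx
    have hab0 : a ≠ 0 := by
      rintro rfl
      apply hx.2
      rw [hs, div_eq_zero_iff]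
      left
      linarith
    have hu := h.u_pos x
    rw [hx.1] at hu ⊢
    rw [norm_zero, Real.zero_rpow hab0]
    rw [zero_mul, mul_zero]
    positivity

/-! ### Weak form of the equation for a logarithm, and energy estimates -/

theorem gradient_eq_zero_of_notMem_tsupport {χ : 𝔼 → ℝ} {x : 𝔼} (hx : x ∉ tsupport χ) :
    ∇ χ x = 0 := by
  have h := notMem_tsupport_iff_eventuallyEq.1 hx
  rw [h.gradient_eq, show (0 : 𝔼 → ℝ) = fun _ => (0 : ℝ) from rfl, gradient_fun_const]

theorem integrable_of_eq_zero_off {χ f : 𝔼 → ℝ} (hc : HasCompactSupport χ) (hf : Continuous f)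
    (h0 : ∀ x, x ∉ tsupport χ → f x = 0) : Integrable f :=
  hf.integrable_of_hasCompactSupport (HasCompactSupport.intro hc h0)

/-- `superPotential F = -Δ F - |∇ F|²`, which is `-Δ S / S` for `S = exp F`. -/
noncomputable def superPotential (F : 𝔼 → ℝ) (x : 𝔼) : ℝ := -(Δ F) x - ‖∇ F x‖ ^ 2

theorem superPotential_log {S : 𝔼 → ℝ} (hS : ContDiff ℝ 2 S) (hpos : ∀ x, 0 < S x) (x : 𝔼) :
    superPotential (fun y => Real.log (S y)) x = -(Δ S) x / S x := by
  rw [superPotential, laplacian_log hS.contDiffAt (hpos x).ne']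
  ring

theorem continuous_superPotential {F : 𝔼 → ℝ} (hF : ContDiff ℝ 2 F) :
    Continuous (superPotential F) :=
  (continuous_laplacian hF).neg.sub ((continuous_gradient (hF.of_le (by norm_num))).norm.pow 2)

theorem contDiff_log {S : 𝔼 → ℝ} (hS : ContDiff ℝ 2 S) (hpos : ∀ x, 0 < S x) :
    ContDiff ℝ 2 fun y => Real.log (S y) := hS.log fun x => (hpos x).ne'

theorem integrable_superPotential_mul_sq {F φ : 𝔼 → ℝ} (hF : ContDiff ℝ 2 F)
    (hφ : ContDiff ℝ 1 φ) (hc : HasCompactSupport φ) :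
    Integrable fun x => superPotential F x * φ x ^ 2 :=
  integrable_of_eq_zero_off hc ((continuous_superPotential hF).mul (hφ.continuous.pow 2))
    fun x hx => by rw [image_eq_zero_of_notMem_tsupport hx]; ring

theorem integrable_norm_gradient_sq {m φ : 𝔼 → ℝ} (hm : Continuous m)
    (hφ : ContDiff ℝ 1 φ) (hc : HasCompactSupport φ) :
    Integrable fun x => m x * ‖∇ φ x‖ ^ 2 :=
  integrable_of_eq_zero_off hc (hm.mul ((continuous_gradient hφ).norm.pow 2))
    fun x hx => by simp [gradient_eq_zero_of_notMem_tsupport hx]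

theorem integrable_superPotential_form {F φ : 𝔼 → ℝ} (hF : ContDiff ℝ 2 F)
    (hφ : ContDiff ℝ 1 φ) (hc : HasCompactSupport φ) :
    Integrable fun x => 2 * ⟪φ x • ∇ F x, ∇ φ x⟫ - ‖φ x • ∇ F x‖ ^ 2 := by
  have h1 := continuous_gradient (hF.of_le (by norm_num : (1 : WithTop ℕ∞) ≤ 2))
  have h2 := continuous_gradient hφ
  have h3 := hφ.continuous
  exact integrable_of_eq_zero_off hc (by fun_prop) fun x hx => by
    simp [gradient_eq_zero_of_notMem_tsupport hx, image_eq_zero_of_notMem_tsupport hx]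

/-- The weak form of `-Δ S = superPotential F * S`, `S = exp F`, tested against `φ² / S`. -/
theorem integral_superPotential_mul_sq {F φ : 𝔼 → ℝ} (hF : ContDiff ℝ 2 F)
    (hφ : ContDiff ℝ 1 φ) (hc : HasCompactSupport φ) :
    ∫ x, superPotential F x * φ x ^ 2 =
      ∫ x, (2 * ⟪φ x • ∇ F x, ∇ φ x⟫ - ‖φ x • ∇ F x‖ ^ 2) := by
  have hφ2 : ContDiff ℝ 1 fun x => φ x * φ x := hφ.mul hφ
  have hc2 : HasCompactSupport fun x => φ x * φ x := hc.mul_left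
  have h := integral_neg_laplacian_mul hF hφ2 hc2
  have h1 := continuous_gradient (hF.of_le (by norm_num : (1 : WithTop ℕ∞) ≤ 2))
  have h3 := hφ.continuous
  have i1 : Integrable fun x => -(Δ F) x * (φ x * φ x) :=
    integrable_of_eq_zero_off hc ((continuous_laplacian hF).neg.mul hφ2.continuous)
      fun x hx => by simp [image_eq_zero_of_notMem_tsupport hx]
  have i2 : Integrable fun x => ‖φ x • ∇ F x‖ ^ 2 :=
    integrable_of_eq_zero_off hc (by fun_prop)
      fun x hx => by simp [image_eq_zero_of_notMem_tsupport hx]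
  have i3 : Integrable fun x => ⟪∇ F x, ∇ (fun x => φ x * φ x) x⟫ :=
    integrable_of_eq_zero_off hc2 (by have := continuous_gradient hφ2; fun_prop)
      fun x hx => by simp [gradient_eq_zero_of_notMem_tsupport hx]
  have e1 : ∀ x, superPotential F x * φ x ^ 2 =
      -(Δ F) x * (φ x * φ x) - ‖φ x • ∇ F x‖ ^ 2 := by
    intro x
    rw [superPotential, norm_smul, mul_pow, Real.norm_eq_abs, sq_abs]
    ring
  have e2 : ∀ x, 2 * ⟪φ x • ∇ F x, ∇ φ x⟫ - ‖φ x • ∇ F x‖ ^ 2 =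
      ⟪∇ F x, ∇ (fun x => φ x * φ x) x⟫ - ‖φ x • ∇ F x‖ ^ 2 := by
    intro x
    have hd := hφ.differentiable (by norm_num) x
    rw [gradient_mul' hd hd, ← two_smul ℝ, inner_smul_right, inner_smul_left, inner_smul_right,
      conj_trivial]
  simp_rw [e1, e2]
  rw [integral_sub i1 i2, integral_sub i3 i2, h]

/-- The inequality `∫ (-Δ S / S) φ² ≤ ∫ |∇ φ|²` for `S = exp F`. -/
theorem integral_superPotential_mul_sq_le {F φ : 𝔼 → ℝ} (hF : ContDiff ℝ 2 F)
    (hφ : ContDiff ℝ 1 φ) (hc : HasCompactSupport φ) :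
    ∫ x, superPotential F x * φ x ^ 2 ≤ ∫ x, ‖∇ φ x‖ ^ 2 := by
  rw [integral_superPotential_mul_sq hF hφ hc]
  refine integral_mono (integrable_superPotential_form hF hφ hc)
    (by simpa using integrable_norm_gradient_sq (m := fun _ => 1) continuous_const hφ hc)
    fun x => ?_
  have := norm_sub_sq_real (φ x • ∇ F x) (∇ φ x)
  simp only
  nlinarith [sq_nonneg ‖φ x • ∇ F x - ∇ φ x‖]

theorem contDiff_exp_mul {G χ : 𝔼 → ℝ} (hG : ContDiff ℝ 2 G) (hχ : ContDiff ℝ 1 χ) :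
    ContDiff ℝ 1 fun x => Real.exp (G x) * χ x :=
  (hG.of_le (by norm_num)).exp.mul hχ

theorem gradient_exp_mul {G χ : 𝔼 → ℝ} (hG : ContDiff ℝ 2 G) (hχ : ContDiff ℝ 1 χ) (x : 𝔼) :
    ∇ (fun x => Real.exp (G x) * χ x) x =
      (Real.exp (G x) * χ x) • ∇ G x + Real.exp (G x) • ∇ χ x := by
  have hGd : DifferentiableAt ℝ G x := hG.differentiable (by norm_num) x
  rw [gradient_mul' hGd.exp (hχ.differentiable (by norm_num) x),
    gradient_comp' (Real.hasDerivAt_exp _) hGd, smul_smul, mul_comm (χ x), add_comm]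

/-- Pointwise identity behind the energy estimates, for `φ = exp (t F) χ`; here `g = ∇ φ`,
`ψ = exp (t F) ∇ χ` and `B = φ ∇ F`. -/
theorem inner_form_identity {t : ℝ} (ht : t ≠ 0) {B g ψ : 𝔼} (h : g = t • B + ψ) :
    2 * ⟪B, g⟫ - ‖B‖ ^ 2 = (2 * t - 1) / t ^ 2 * ‖g‖ ^ 2 - 2 * ((t - 1) / t ^ 2) * ⟪g, ψ⟫ -
      ‖ψ‖ ^ 2 / t ^ 2 := by
  rw [h]
  simp only [← real_inner_self_eq_norm_sq, inner_add_left, inner_add_right, inner_smul_left,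
    inner_smul_right, conj_trivial]
  rw [real_inner_comm B ψ]
  field_simp
  ring

theorem gradient_exp_const_mul_mul {F χ : 𝔼 → ℝ} (hF : ContDiff ℝ 2 F) (hχ : ContDiff ℝ 1 χ)
    (t : ℝ) (x : 𝔼) :
    ∇ (fun x => Real.exp (t * F x) * χ x) x =
      t • ((Real.exp (t * F x) * χ x) • ∇ F x) + Real.exp (t * F x) • ∇ χ x := by
  rw [gradient_exp_mul (contDiff_const.mul hF) hχ,
    gradient_const_mul' t (hF.differentiable (by norm_num) x), smul_comm]

/-- If the quadratic form of `-Δ u / u`, `u = exp F`, is bounded by `κ` times the Dirichlet form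
with `κ < (2 t - 1) / t²`, then the Dirichlet energy of `u^t χ` is controlled by
`∫ u^{2t} |∇ χ|²`. -/
theorem energy_of_form_bound {F : 𝔼 → ℝ} (hF : ContDiff ℝ 2 F) {t κ : ℝ} (ht : 0 < t)
    (hκ : κ < (2 * t - 1) / t ^ 2)
    (hform : ∀ φ : 𝔼 → ℝ, ContDiff ℝ 1 φ → HasCompactSupport φ →
      ∫ x, superPotential F x * φ x ^ 2 ≤ κ * ∫ x, ‖∇ φ x‖ ^ 2) :
    ∃ C : ℝ, ∀ χ : 𝔼 → ℝ, ContDiff ℝ 1 χ → HasCompactSupport χ →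
      ∫ x, ‖∇ (fun x => Real.exp (t * F x) * χ x) x‖ ^ 2 ≤
        C * ∫ x, Real.exp (t * F x) ^ 2 * ‖∇ χ x‖ ^ 2 := by
  set d := (2 * t - 1) / t ^ 2 - κ with hd
  have hd0 : 0 < d := sub_pos.2 hκ
  set c := (t - 1) / t ^ 2 with hc
  refine ⟨(2 / d) * (2 * c ^ 2 / d + 1 / t ^ 2), fun χ hχ hcs => ?_⟩
  have hG : ContDiff ℝ 2 fun x => t * F x := contDiff_const.mul hF
  set φ := fun x => Real.exp (t * F x) * χ x with hφ
  have hφC : ContDiff ℝ 1 φ := contDiff_exp_mul hG hχ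
  have hφc : HasCompactSupport φ := hcs.mul_left
  have h1 := hform φ hφC hφc
  rw [integral_superPotential_mul_sq hF hφC hφc] at h1
  have iψ : Integrable fun x => Real.exp (t * F x) ^ 2 * ‖∇ χ x‖ ^ 2 :=
    integrable_norm_gradient_sq (hG.exp.continuous.pow 2) hχ hcs
  have ig : Integrable fun x => ‖∇ φ x‖ ^ 2 := by
    simpa using integrable_norm_gradient_sq (m := fun _ => 1) continuous_const hφC hφc
  have h2 : ∫ x, ((κ + d / 2) * ‖∇ φ x‖ ^ 2 - (2 * c ^ 2 / d + 1 / t ^ 2) *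
      (Real.exp (t * F x) ^ 2 * ‖∇ χ x‖ ^ 2)) ≤
      ∫ x, (2 * ⟪φ x • ∇ F x, ∇ φ x⟫ - ‖φ x • ∇ F x‖ ^ 2) := by
    refine integral_mono ((ig.const_mul _).sub (iψ.const_mul _))
      (integrable_superPotential_form hF hφC hφc) fun x => ?_
    simp only
    rw [inner_form_identity ht.ne' (gradient_exp_const_mul_mul hF hχ t x)]
    set g := ∇ φ x
    set ψ := Real.exp (t * F x) • ∇ χ x with hψ
    have e : Real.exp (t * F x) ^ 2 * ‖∇ χ x‖ ^ 2 = ‖ψ‖ ^ 2 := by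
      rw [hψ, norm_smul, mul_pow, Real.norm_eq_abs, sq_abs]
    rw [e, ← hc]
    have h3 : 0 ≤ ‖g - (2 * c / d) • ψ‖ ^ 2 := by positivity
    rw [norm_sub_sq_real, inner_smul_right, norm_smul, mul_pow, Real.norm_eq_abs, sq_abs] at h3
    have h4 := mul_nonneg (half_pos hd0).le h3
    have h5 : d / 2 * (‖g‖ ^ 2 - 2 * (2 * c / d * ⟪g, ψ⟫) + (2 * c / d) ^ 2 * ‖ψ‖ ^ 2) =
        d / 2 * ‖g‖ ^ 2 - 2 * c * ⟪g, ψ⟫ + 2 * c ^ 2 / d * ‖ψ‖ ^ 2 := by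
      field_simp
    have h6 : (2 * t - 1) / t ^ 2 = κ + d := by rw [hd]; ring
    rw [h6]
    rw [h5] at h4
    have h7 : (2 * c ^ 2 / d + 1 / t ^ 2) * ‖ψ‖ ^ 2 =
      2 * c ^ 2 / d * ‖ψ‖ ^ 2 + ‖ψ‖ ^ 2 / t ^ 2 := by ring
    rw [h7]
    linarith
  rw [integral_sub (ig.const_mul _) (iψ.const_mul _), integral_const_mul, integral_const_mul] at h2
  have h3 : d / 2 * ∫ x, ‖∇ φ x‖ ^ 2 ≤ (2 * c ^ 2 / d + 1 / t ^ 2) *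
      ∫ x, Real.exp (t * F x) ^ 2 * ‖∇ χ x‖ ^ 2 := by linarith
  have h4 := mul_le_mul_of_nonneg_left h3 (show 0 ≤ 2 / d by positivity)
  have h5 : 2 / d * (d / 2 * ∫ x, ‖∇ φ x‖ ^ 2) = ∫ x, ‖∇ φ x‖ ^ 2 := by field_simp
  rw [h5] at h4
  linarith

/-- For `φ = u χ`, `u = exp F`, the Dirichlet energy is computed exactly. -/
theorem integral_norm_gradient_exp_mul {F χ : 𝔼 → ℝ} (hF : ContDiff ℝ 2 F)
    (hχ : ContDiff ℝ 1 χ) (hcs : HasCompactSupport χ) :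
    ∫ x, ‖∇ (fun x => Real.exp (1 * F x) * χ x) x‖ ^ 2 =
      (∫ x, superPotential F x * (Real.exp (1 * F x) * χ x) ^ 2) +
        ∫ x, Real.exp (1 * F x) ^ 2 * ‖∇ χ x‖ ^ 2 := by
  have hG : ContDiff ℝ 2 fun x => 1 * F x := contDiff_const.mul hF
  set φ := fun x => Real.exp (1 * F x) * χ x with hφ
  have hφC : ContDiff ℝ 1 φ := contDiff_exp_mul hG hχ
  have hφc : HasCompactSupport φ := hcs.mul_left
  have iψ : Integrable fun x => Real.exp (1 * F x) ^ 2 * ‖∇ χ x‖ ^ 2 :=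
    integrable_norm_gradient_sq (hG.exp.continuous.pow 2) hχ hcs
  rw [integral_superPotential_mul_sq hF hφC hφc,
    ← integral_add (integrable_superPotential_form hF hφC hφc) iψ]
  refine integral_congr_ae (.of_forall fun x => ?_)
  simp only
  rw [inner_form_identity one_ne_zero (gradient_exp_const_mul_mul hF hχ 1 x), norm_smul, mul_pow,
    Real.norm_eq_abs, sq_abs]
  ring

/-! ### The borderline energy estimate -/

/-- Pointwise algebra: with `b, a, h` the vectors `Φ ∇ ln v`, `Φ ∇ ln u`, `Φ ∇ ln h` and
`g = k b + (1 - k) h + ψ` the gradient of `Φ = v^k h^{1-k} χ`. -/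
theorem critical_form_lower_bound (k : ℝ) {a b h g ψ : 𝔼}
    (hg : g = k • b + (1 - k) • h + ψ) :
    k * (k - 1) * ‖b - h‖ ^ 2 - ‖ψ‖ ^ 2 ≤
      k * (2 * ⟪b, g⟫ - ‖b‖ ^ 2) - (2 * ⟪a, g⟫ - ‖a‖ ^ 2) -
        (k - 1) * (2 * ⟪h, g⟫ - ‖h‖ ^ 2) := by
  have h0 : 0 ≤ ‖k • b + (1 - k) • h - a + ψ‖ ^ 2 := by positivity
  have e : k * (2 * ⟪b, g⟫ - ‖b‖ ^ 2) - (2 * ⟪a, g⟫ - ‖a‖ ^ 2) -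
        (k - 1) * (2 * ⟪h, g⟫ - ‖h‖ ^ 2) - (k * (k - 1) * ‖b - h‖ ^ 2 - ‖ψ‖ ^ 2) =
      ‖k • b + (1 - k) • h - a + ψ‖ ^ 2 := by
    rw [hg]
    simp only [← real_inner_self_eq_norm_sq, inner_add_left, inner_add_right, inner_smul_left,
      inner_smul_right, inner_sub_left, inner_sub_right, conj_trivial]
    rw [real_inner_comm b a, real_inner_comm h a, real_inner_comm ψ a, real_inner_comm h b,
      real_inner_comm ψ b, real_inner_comm ψ h]
    ring
  linarith

/-- Companion of `critical_form_lower_bound`: the form of `v` minus that of `h` is controlled by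
the gradient term `|∇ ln v - ∇ ln h|²`. -/
theorem critical_form_upper_bound (k : ℝ) {b h g ψ : 𝔼}
    (hg : g = k • b + (1 - k) • h + ψ) :
    (2 * ⟪b, g⟫ - ‖b‖ ^ 2) - (2 * ⟪h, g⟫ - ‖h‖ ^ 2) ≤ 2 * k * ‖b - h‖ ^ 2 + ‖ψ‖ ^ 2 := by
  have h0 : 0 ≤ ‖b - h - ψ‖ ^ 2 := by positivity
  have e : 2 * k * ‖b - h‖ ^ 2 + ‖ψ‖ ^ 2 - ((2 * ⟪b, g⟫ - ‖b‖ ^ 2) - (2 * ⟪h, g⟫ - ‖h‖ ^ 2)) =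
      ‖b - h - ψ‖ ^ 2 := by
    rw [hg]
    simp only [← real_inner_self_eq_norm_sq, inner_add_right, inner_smul_right, inner_sub_left,
      inner_sub_right]
    rw [real_inner_comm h b, real_inner_comm ψ b, real_inner_comm ψ h]
    ring
  linarith

/-- The estimate that replaces the strict inequality `t² / (2 t - 1) < √θ` when `θ = 1`.
Here `u = exp U`, `v = exp V`, `h = exp P` is superharmonic and `z = exp (c + k V + (1 - k) P)`.
The deficit `D` in the comparison property has a controlled integral; where `D` is small, `z` is
comparable to `u`, and the gradient terms gained from `z` being a *convex* power of `v` control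
the rest. -/
theorem critical_estimate {U V P D χ : 𝔼 → ℝ} (hU : ContDiff ℝ 2 U) (hV : ContDiff ℝ 2 V)
    (hP : ContDiff ℝ 2 P) (hD : Continuous D) {k c C L : ℝ} (hk : 1 < k) (hC : 0 ≤ C)
    (hPs : ∀ x, 0 ≤ superPotential P x)
    (hχ : ContDiff ℝ 1 χ) (hcs : HasCompactSupport χ)
    (hDχ : ∫ x, D x * (Real.exp (1 * U x) * χ x) ^ 2 ≤ L)
    (hL : ∫ x, Real.exp (1 * U x) ^ 2 * ‖∇ χ x‖ ^ 2 = L)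
    (h1 : ∀ x ∈ tsupport χ, (k * superPotential V x - superPotential U x) *
      Real.exp (c + (k * V x + (1 - k) * P x)) ^ 2 ≤ C * (D x * Real.exp (1 * U x) ^ 2))
    (h2 : ∀ x ∈ tsupport χ, superPotential U x * Real.exp (1 * U x) ^ 2 ≤
      C * (D x * Real.exp (1 * U x) ^ 2 +
        superPotential V x * Real.exp (c + (k * V x + (1 - k) * P x)) ^ 2))
    (h3 : ∀ x ∈ tsupport χ, Real.exp (c + (k * V x + (1 - k) * P x)) ^ 2 ≤
      C * Real.exp (1 * U x) ^ 2) :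
    ∫ x, superPotential U x * (Real.exp (1 * U x) * χ x) ^ 2 ≤
      C * (L + 3 / (k - 1) * (2 * C * L) + C * L) := by
  set G : 𝔼 → ℝ := fun x => c + (k * V x + (1 - k) * P x) with hG
  have hGC : ContDiff ℝ 2 G :=
    contDiff_const.add ((contDiff_const.mul hV).add (contDiff_const.mul hP))
  set Φ : 𝔼 → ℝ := fun x => Real.exp (G x) * χ x with hΦ
  have hΦC : ContDiff ℝ 1 Φ := contDiff_exp_mul hGC hχ
  have hΦc : HasCompactSupport Φ := hcs.mul_left
  have hUC : ContDiff ℝ 2 fun x => 1 * U x := contDiff_const.mul hU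
  set φ : 𝔼 → ℝ := fun x => Real.exp (1 * U x) * χ x with hφ
  have hφC : ContDiff ℝ 1 φ := contDiff_exp_mul hUC hχ
  have hφc : HasCompactSupport φ := hcs.mul_left
  have one2 : (1 : WithTop ℕ∞) ≤ 2 := by norm_num
  have two0 : (2 : WithTop ℕ∞) ≠ 0 := by norm_num
  have gV := continuous_gradient (hV.of_le one2)
  have gP := continuous_gradient (hP.of_le one2)
  have cΦ := hΦC.continuous
  have hgrad : ∀ x, ∇ Φ x = k • (Φ x • ∇ V x) + (1 - k) • (Φ x • ∇ P x) +
      Real.exp (G x) • ∇ χ x := by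
    intro x
    have dV := hV.differentiable two0 x
    have dP := hP.differentiable two0 x
    have eG : ∇ G x = k • ∇ V x + (1 - k) • ∇ P x := by
      rw [hG, gradient_add' (g := fun x => k * V x + (1 - k) * P x) (differentiableAt_const c)
          ((dV.const_mul k).add (dP.const_mul (1 - k))),
        gradient_add' (dV.const_mul k) (dP.const_mul (1 - k)), gradient_const_mul' _ dV,
        gradient_const_mul' _ dP, gradient_fun_const, zero_add]
    rw [hΦ, gradient_exp_mul hGC hχ, eG, smul_add, smul_comm _ k, smul_comm _ (1 - k)]
  have iU := integrable_superPotential_mul_sq hU hΦC hΦc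
  have iV := integrable_superPotential_mul_sq hV hΦC hΦc
  have iP := integrable_superPotential_mul_sq hP hΦC hΦc
  have fU := integrable_superPotential_form hU hΦC hΦc
  have fV := integrable_superPotential_form hV hΦC hΦc
  have fP := integrable_superPotential_form hP hΦC hΦc
  have fVU : Integrable fun x => k * (2 * ⟪Φ x • ∇ V x, ∇ Φ x⟫ - ‖Φ x • ∇ V x‖ ^ 2) -
      (2 * ⟪Φ x • ∇ U x, ∇ Φ x⟫ - ‖Φ x • ∇ U x‖ ^ 2) := (fV.const_mul k).sub fU
  have iψ : Integrable fun x => ‖Real.exp (G x) • ∇ χ x‖ ^ 2 := by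
    have := integrable_norm_gradient_sq (hGC.exp.continuous.pow 2) hχ hcs
    refine this.congr (.of_forall fun x => ?_)
    simp only [norm_smul, mul_pow, Real.norm_eq_abs, sq_abs, Pi.pow_apply]
  have iu : Integrable fun x => Real.exp (1 * U x) ^ 2 * ‖∇ χ x‖ ^ 2 :=
    integrable_norm_gradient_sq (hUC.exp.continuous.pow 2) hχ hcs
  have iE : Integrable fun x => ‖Φ x • ∇ V x - Φ x • ∇ P x‖ ^ 2 :=
    integrable_of_eq_zero_off hΦc (by fun_prop) fun x hx => by
      simp [image_eq_zero_of_notMem_tsupport hx]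
  have iD : Integrable fun x => D x * φ x ^ 2 :=
    integrable_of_eq_zero_off hφc (hD.mul (hφC.continuous.pow 2)) fun x hx => by
      simp [image_eq_zero_of_notMem_tsupport hx]
  have hzero : ∀ x, x ∉ tsupport χ → χ x = 0 := fun x hx => image_eq_zero_of_notMem_tsupport hx
  set E := ∫ x, ‖Φ x • ∇ V x - Φ x • ∇ P x‖ ^ 2 with hE
  have hE0 : 0 ≤ E := integral_nonneg fun x => by positivity
  have hP0 : 0 ≤ ∫ x, superPotential P x * Φ x ^ 2 :=
    integral_nonneg fun x => mul_nonneg (hPs x) (by positivity)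
  -- the cutoff term is controlled by `L`
  have hψL : ∫ x, ‖Real.exp (G x) • ∇ χ x‖ ^ 2 ≤ C * L := by
    rw [← hL, ← integral_const_mul]
    refine integral_mono iψ (iu.const_mul C) fun x => ?_
    simp only [norm_smul, mul_pow, Real.norm_eq_abs, sq_abs, ← mul_assoc]
    by_cases hx : x ∈ tsupport χ
    · exact mul_le_mul_of_nonneg_right (h3 x hx) (by positivity)
    · simp [gradient_eq_zero_of_notMem_tsupport hx]
  -- first identity: gain of the gradient terms
  have hA : k * (k - 1) * E - C * L + (k - 1) * ∫ x, superPotential P x * Φ x ^ 2 ≤ C * L := by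
    have e1 : k * (k - 1) * E - ∫ x, ‖Real.exp (G x) • ∇ χ x‖ ^ 2 ≤
        k * (∫ x, superPotential V x * Φ x ^ 2) - (∫ x, superPotential U x * Φ x ^ 2) -
          (k - 1) * ∫ x, superPotential P x * Φ x ^ 2 := by
      rw [integral_superPotential_mul_sq hU hΦC hΦc, integral_superPotential_mul_sq hV hΦC hΦc,
        integral_superPotential_mul_sq hP hΦC hΦc, hE, ← integral_const_mul, ← integral_const_mul,
        ← integral_const_mul, ← integral_sub (iE.const_mul _) iψ,
        ← integral_sub (fV.const_mul _) fU,
        ← integral_sub fVU (fP.const_mul _)]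
      exact integral_mono ((iE.const_mul _).sub iψ) (fVU.sub (fP.const_mul _))
        fun x => critical_form_lower_bound k (hgrad x)
    have e2 : k * (∫ x, superPotential V x * Φ x ^ 2) - (∫ x, superPotential U x * Φ x ^ 2) ≤
        C * L := by
      refine le_trans ?_ (mul_le_mul_of_nonneg_left hDχ hC)
      rw [← integral_const_mul, ← integral_const_mul, ← integral_sub (iV.const_mul _) iU]
      refine integral_mono ((iV.const_mul _).sub iU) (iD.const_mul _) fun x => ?_
      simp only [hΦ]
      by_cases hx : x ∈ tsupport χ
      · have := mul_le_mul_of_nonneg_right (h1 x hx) (sq_nonneg (χ x))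
        linarith
      · simp [hzero x hx]
    linarith
  -- second identity: control of the zeroth order term by the gradient terms
  have hB : ∫ x, superPotential V x * Φ x ^ 2 ≤
      (∫ x, superPotential P x * Φ x ^ 2) + 2 * k * E + C * L := by
    have e1 : (∫ x, superPotential V x * Φ x ^ 2) - ∫ x, superPotential P x * Φ x ^ 2 ≤
        2 * k * E + ∫ x, ‖Real.exp (G x) • ∇ χ x‖ ^ 2 := by
      rw [integral_superPotential_mul_sq hV hΦC hΦc, integral_superPotential_mul_sq hP hΦC hΦc, hE,
        ← integral_const_mul, ← integral_sub fV fP, ← integral_add (iE.const_mul _) iψ]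
      exact integral_mono (fV.sub fP) ((iE.const_mul _).add iψ)
        fun x => critical_form_upper_bound k (hgrad x)
    linarith
  have hk1 : 0 < k - 1 := by linarith
  -- the factor `3 / (k - 1)` makes the left side of `hA` dominate both terms of `hB`
  have hY : ∫ x, superPotential V x * Φ x ^ 2 ≤ 3 / (k - 1) * (2 * C * L) + C * L := by
    set R := ∫ x, superPotential P x * Φ x ^ 2
    have e3 : 3 / (k - 1) * (k * (k - 1) * E + (k - 1) * R) = 3 * k * E + 3 * R := by
      field_simp
    have e4 := mul_le_mul_of_nonneg_left
      (show k * (k - 1) * E + (k - 1) * R ≤ 2 * C * L by linarith)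
      (show 0 ≤ 3 / (k - 1) by positivity)
    rw [e3] at e4
    have : 0 ≤ k * E := by positivity
    linarith
  calc ∫ x, superPotential U x * φ x ^ 2
      ≤ ∫ x, C * (D x * φ x ^ 2 + superPotential V x * Φ x ^ 2) := by
        refine integral_mono (integrable_superPotential_mul_sq hU hφC hφc)
          ((iD.add iV).const_mul C) fun x => ?_
        simp only [hΦ, hφ]
        by_cases hx : x ∈ tsupport χ
        · have := mul_le_mul_of_nonneg_right (h2 x hx) (sq_nonneg (χ x))
          linarith
        · simp [hzero x hx]
    _ ≤ _ := by
        rw [integral_const_mul, integral_add iD iV]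
        refine mul_le_mul_of_nonneg_left ?_ hC
        linarith

/-- A point has zero capacity in dimension at least three: an energy inequality that is valid for
cutoff functions vanishing near the origin holds for all cutoff functions. -/
theorem extend_across_origin (hN : 3 ≤ N) {X m : 𝔼 → ℝ} (hX : Continuous X) (hm : Continuous m)
    (hm0 : ∀ x, 0 ≤ m x) {C : ℝ} (hC : 0 ≤ C)
    (h : ∀ χ : 𝔼 → ℝ, ContDiff ℝ 1 χ → HasCompactSupport χ → 0 ∉ tsupport χ →
      ∫ x, X x * χ x ^ 2 ≤ C * ∫ x, m x * ‖∇ χ x‖ ^ 2)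
    {χ : 𝔼 → ℝ} (hχ : ContDiff ℝ 1 χ) (hcs : HasCompactSupport χ) :
    ∫ x, X x * χ x ^ 2 ≤ 2 * C * ∫ x, m x * ‖∇ χ x‖ ^ 2 := by
  let β : ContDiffBump (0 : 𝔼) := ⟨1, 2, one_pos, one_lt_two⟩
  have hβC : ContDiff ℝ 1 (β : 𝔼 → ℝ) := β.contDiff
  have hβd : Differentiable ℝ (β : 𝔼 → ℝ) := hβC.differentiable (by norm_num)
  set ρ : ℕ → 𝔼 → ℝ := fun n x => 1 - β ((0 : 𝔼) + ((n : ℝ) + 1) • x) with hρ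
  have hρC : ∀ n, ContDiff ℝ 1 (ρ n) := fun n => contDiff_const.sub (hβC.comp (by fun_prop))
  have hρ1 : ∀ n x, |ρ n x| ≤ 1 := fun n x => by
    rw [abs_le]
    constructor <;> simp only [hρ] <;>
      linarith [β.nonneg (x := (0 : 𝔼) + ((n : ℝ) + 1) • x),
        β.le_one (x := (0 : 𝔼) + ((n : ℝ) + 1) • x)]
  have hρg : ∀ n x, ‖∇ (ρ n) x‖ ^ 2 = ((n : ℝ) + 1) ^ 2 *
      ‖∇ (β : 𝔼 → ℝ) (((n : ℝ) + 1) • x)‖ ^ 2 := by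
    intro n x
    have e : ρ n = fun x => 1 + (-1) * β ((0 : 𝔼) + ((n : ℝ) + 1) • x) := by
      funext x; simp only [hρ]; ring
    have hd : DifferentiableAt ℝ (fun x => β ((0 : 𝔼) + ((n : ℝ) + 1) • x)) x :=
      (hβC.comp (by fun_prop : ContDiff ℝ 1 fun x : 𝔼 =>
        (0 : 𝔼) + ((n : ℝ) + 1) • x)).differentiable (by norm_num) x
    rw [e, gradient_add' (differentiableAt_const _) (hd.const_mul _), gradient_const_mul' _ hd,
      gradient_comp_const_smul hβd, gradient_fun_const, zero_add, zero_add, norm_smul, norm_smul]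
    rw [Real.norm_eq_abs, Real.norm_eq_abs, mul_pow, mul_pow, sq_abs, sq_abs]
    ring
  set χn : ℕ → 𝔼 → ℝ := fun n x => χ x * ρ n x with hχn
  have hχnC : ∀ n, ContDiff ℝ 1 (χn n) := fun n => hχ.mul (hρC n)
  have hχnc : ∀ n, HasCompactSupport (χn n) := fun n => hcs.mul_right
  have hχn0 : ∀ n, (0 : 𝔼) ∉ tsupport (χn n) := by
    intro n
    rw [notMem_tsupport_iff_eventuallyEq]
    have : Tendsto (fun x : 𝔼 => (0 : 𝔼) + ((n : ℝ) + 1) • x) (𝓝 0) (𝓝 0) := by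
      have : Continuous (fun x : 𝔼 => (0 : 𝔼) + ((n : ℝ) + 1) • x) := by fun_prop
      simpa using this.tendsto 0
    filter_upwards [this.eventually β.eventuallyEq_one] with x hx
    simp only [hχn, hρ, Pi.zero_apply]
    rw [hx]
    simp
  -- by scaling, the Dirichlet energy of `ρ n` is of order `n^{2-N}`
  have cmχ : Continuous fun x => m x * χ x ^ 2 := hm.mul (hχ.continuous.pow 2)
  obtain ⟨S, hS⟩ := cmχ.bounded_above_of_compact_support
    (HasCompactSupport.intro hcs fun x hx => by simp [image_eq_zero_of_notMem_tsupport hx])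
  have hS0 : 0 ≤ S := (norm_nonneg _).trans (hS 0)
  have iβ : Integrable fun x => ‖∇ (β : 𝔼 → ℝ) x‖ ^ 2 := by
    simpa using integrable_norm_gradient_sq (m := fun _ => 1) continuous_const hβC
      β.hasCompactSupport
  set B := ∫ x, ‖∇ (β : 𝔼 → ℝ) x‖ ^ 2 with hB
  have hB0 : 0 ≤ B := integral_nonneg fun x => by positivity
  have iρ : ∀ n, Integrable fun x => ‖∇ (ρ n) x‖ ^ 2 := fun n => by
    have hn : (n : ℝ) + 1 ≠ 0 := by positivity
    simp_rw [hρg]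
    exact (iβ.comp_smul hn).const_mul _
  have hBn : ∀ n, ∫ x, ‖∇ (ρ n) x‖ ^ 2 ≤ B / ((n : ℝ) + 1) := by
    intro n
    have hn : 1 ≤ (n : ℝ) + 1 := by linarith [n.cast_nonneg (α := ℝ)]
    simp_rw [hρg]
    rw [integral_const_mul, Measure.integral_comp_smul volume (fun x => ‖∇ (β : 𝔼 → ℝ) x‖ ^ 2),
      ← hB, finrank_euclideanSpace, Fintype.card_fin, abs_of_pos (by positivity), smul_eq_mul,
      ← mul_assoc, div_eq_mul_inv, mul_comm B]
    refine mul_le_mul_of_nonneg_right ?_ hB0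
    rw [← div_eq_mul_inv, div_le_iff₀ (by positivity), inv_mul_eq_div, le_div_iff₀ (by positivity),
      ← pow_succ]
    exact pow_le_pow_right₀ hn hN
  have iχ : Integrable fun x => m x * ‖∇ χ x‖ ^ 2 := integrable_norm_gradient_sq hm hχ hcs
  have key : ∀ n, ∫ x, X x * χn n x ^ 2 ≤
      2 * C * (∫ x, m x * ‖∇ χ x‖ ^ 2) + 2 * C * S * (B / ((n : ℝ) + 1)) := by
    intro n
    refine (h _ (hχnC n) (hχnc n) (hχn0 n)).trans ?_
    have e : ∫ x, m x * ‖∇ (χn n) x‖ ^ 2 ≤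
        ∫ x, (2 * (m x * ‖∇ χ x‖ ^ 2) + 2 * S * ‖∇ (ρ n) x‖ ^ 2) := by
      refine integral_mono (integrable_norm_gradient_sq hm (hχnC n) (hχnc n))
        ((iχ.const_mul 2).add ((iρ n).const_mul _)) fun x => ?_
      simp only [hχn]
      rw [gradient_mul' (hχ.differentiable (by norm_num) x)
        ((hρC n).differentiable (by norm_num) x)]
      have h1 : ‖χ x • ∇ (ρ n) x + ρ n x • ∇ χ x‖ ^ 2 ≤
          2 * (χ x ^ 2 * ‖∇ (ρ n) x‖ ^ 2) + 2 * ‖∇ χ x‖ ^ 2 := by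
        have h2 := norm_add_le (χ x • ∇ (ρ n) x) (ρ n x • ∇ χ x)
        have h3 : ‖ρ n x • ∇ χ x‖ ≤ ‖∇ χ x‖ := by
          rw [norm_smul]
          exact mul_le_of_le_one_left (norm_nonneg _) (hρ1 n x)
        have h4 : ‖χ x • ∇ (ρ n) x‖ ^ 2 = χ x ^ 2 * ‖∇ (ρ n) x‖ ^ 2 := by
          rw [norm_smul, mul_pow, Real.norm_eq_abs, sq_abs]
        rw [← h4]
        have h5 : ‖χ x • ∇ (ρ n) x + ρ n x • ∇ χ x‖ ^ 2 ≤
            (‖χ x • ∇ (ρ n) x‖ + ‖∇ χ x‖) ^ 2 := by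
          gcongr
          linarith
        nlinarith [sq_nonneg (‖χ x • ∇ (ρ n) x‖ - ‖∇ χ x‖)]
      have h6 : m x * χ x ^ 2 ≤ S := (Real.le_norm_self _).trans (hS x)
      have h7 := mul_le_mul_of_nonneg_left h1 (hm0 x)
      have h8 := mul_le_mul_of_nonneg_right h6 (sq_nonneg ‖∇ (ρ n) x‖)
      linarith
    rw [integral_add (iχ.const_mul 2) ((iρ n).const_mul _), integral_const_mul,
      integral_const_mul] at e
    have e2 := mul_le_mul_of_nonneg_left (hBn n) hS0
    have e3 := mul_le_mul_of_nonneg_left (show ∫ x, m x * ‖∇ (χn n) x‖ ^ 2 ≤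
      2 * (∫ x, m x * ‖∇ χ x‖ ^ 2) + 2 * (S * (B / ((n : ℝ) + 1))) by linarith) hC
    linarith
  have lim1 : Tendsto (fun n => ∫ x, X x * χn n x ^ 2) atTop (𝓝 (∫ x, X x * χ x ^ 2)) := by
    have : Nonempty (Fin N) := ⟨⟨0, by omega⟩⟩
    have iX : Integrable fun x => |X x| * χ x ^ 2 :=
      integrable_of_eq_zero_off hcs (hX.abs.mul (hχ.continuous.pow 2)) fun x hx => by
        simp [image_eq_zero_of_notMem_tsupport hx]
    refine tendsto_integral_of_dominated_convergence (fun x => |X x| * χ x ^ 2)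
      (fun n => (hX.mul ((hχnC n).continuous.pow 2)).aestronglyMeasurable) iX
      (fun n => .of_forall fun x => ?_) ?_
    · rw [norm_mul, Real.norm_eq_abs, norm_pow, Real.norm_eq_abs, sq_abs]
      refine mul_le_mul_of_nonneg_left ?_ (abs_nonneg _)
      simp only [hχn, mul_pow]
      refine mul_le_of_le_one_right (sq_nonneg _) ?_
      rw [← sq_abs]
      exact pow_le_one₀ (abs_nonneg _) (hρ1 n x)
    · have h0 : ∀ᵐ x : 𝔼, x ≠ 0 := by
        rw [ae_iff]
        simp
      filter_upwards [h0] with x hx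
      have hx0 : 0 < ‖x‖ := norm_pos_iff.2 hx
      refine tendsto_const_nhds.congr' ?_
      filter_upwards [eventually_ge_atTop ⌈2 / ‖x‖⌉₊] with n hn
      have h1 : 2 / ‖x‖ ≤ n := (Nat.le_ceil _).trans (by exact_mod_cast hn)
      rw [div_le_iff₀ hx0] at h1
      have h2 : β ((0 : 𝔼) + ((n : ℝ) + 1) • x) = 0 := by
        refine β.zero_of_le_dist ?_
        rw [zero_add, dist_zero_right, norm_smul, Real.norm_of_nonneg (by positivity)]
        change (2 : ℝ) ≤ _
        linarith
      simp only [hχn, hρ, h2]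
      ring
  have lim2 : Tendsto (fun n : ℕ => 2 * C * (∫ x, m x * ‖∇ χ x‖ ^ 2) +
      2 * C * S * (B / ((n : ℝ) + 1))) atTop (𝓝 (2 * C * (∫ x, m x * ‖∇ χ x‖ ^ 2) +
        2 * C * S * 0)) := by
    refine tendsto_const_nhds.add (Tendsto.const_mul _ ?_)
    exact Tendsto.const_div_atTop (tendsto_natCast_atTop_atTop.atTop_add tendsto_const_nhds) B
  rw [mul_zero, add_zero] at lim2
  exact le_of_tendsto_of_tendsto' lim1 lim2 key

/-! ### Cutoff functions and scaling -/

/-- Splitting the cutoff term: either the superlinear term absorbs it, or `u` is so small that it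
is bounded by a power of `R`. -/
theorem cutoff_term_le {κ γ t δ M R r β F : ℝ} {m : ℕ} (hκ : 0 ≤ κ) (hγ : 0 < γ) (ht : 0 < t)
    (hδ : 0 < δ) (hM : 0 ≤ M) (hR : 0 < R) (hr : R ≤ r) (hβ : 0 ≤ β) (hβ1 : β ≤ 1)
    (hm : 2 * t / γ ≤ m) :
    Real.exp (t * F) ^ 2 * (M * (R ^ 2)⁻¹ * (β ^ m) ^ 2) ≤
      δ * (r ^ κ * Real.exp (γ * F) * (Real.exp (t * F) * β ^ (m + 1)) ^ 2) +
        M * (M / δ) ^ (2 * t / γ) * R ^ (-2 - 2 * t * ((κ + 2) / γ)) := by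
  have hr0 : 0 < r := hR.trans_le hr
  have hR2 : R ^ (-2 - 2 * t * ((κ + 2) / γ)) =
      (R ^ 2)⁻¹ * (R ^ (-(κ + 2))) ^ (2 * t / γ) := by
    rw [← Real.rpow_mul hR.le, ← Real.rpow_natCast, ← Real.rpow_neg hR.le, ← Real.rpow_add hR]
    congr 1
    push_cast
    field_simp
    ring
  rcases le_or_gt M (δ * (R ^ (κ + 2) * (Real.exp (γ * F) * β ^ 2))) with h | h
  · have h1 : Real.exp (t * F) ^ 2 * (M * (R ^ 2)⁻¹ * (β ^ m) ^ 2) ≤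
        δ * (r ^ κ * Real.exp (γ * F) * (Real.exp (t * F) * β ^ (m + 1)) ^ 2) := by
      calc _ ≤ Real.exp (t * F) ^ 2 * (δ * (R ^ (κ + 2) * (Real.exp (γ * F) * β ^ 2)) *
            (R ^ 2)⁻¹ * (β ^ m) ^ 2) := by gcongr
        _ = δ * (R ^ κ * Real.exp (γ * F) * (Real.exp (t * F) * β ^ (m + 1)) ^ 2) := by
            rw [Real.rpow_add hR, show R ^ (2 : ℝ) = R ^ 2 from by norm_cast]
            field_simp
            ring
        _ ≤ _ := by gcongr
    have : 0 ≤ M * (M / δ) ^ (2 * t / γ) * R ^ (-2 - 2 * t * ((κ + 2) / γ)) := by positivity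
    linarith
  · have h1 : Real.exp (γ * F) * β ^ 2 ≤ M / δ * R ^ (-(κ + 2)) := by
      rw [Real.rpow_neg hR.le, ← div_eq_mul_inv, le_div_iff₀ (by positivity),
        le_div_iff₀ hδ]
      linarith
    have h2 := Real.rpow_le_rpow (by positivity) h1 (show 0 ≤ 2 * t / γ by positivity)
    rw [Real.mul_rpow (by positivity) (by positivity),
      Real.mul_rpow (by positivity) (by positivity), ← Real.exp_mul] at h2
    have h3 : Real.exp (γ * F * (2 * t / γ)) = Real.exp (t * F) ^ 2 := by
      rw [← Real.exp_nat_mul]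
      congr 1
      push_cast
      field_simp
    have h4 : (β ^ m) ^ 2 ≤ (β ^ 2) ^ (2 * t / γ) := by
      rcases eq_or_lt_of_le hβ with rfl | hβ0
      · have : m ≠ 0 := by
          rintro rfl
          have : 0 < 2 * t / γ := by positivity
          simp at hm
          linarith
        simp only [ne_eq, this, not_false_eq_true, zero_pow, OfNat.ofNat_ne_zero]
        positivity
      · rw [← pow_mul, mul_comm m, pow_mul, ← Real.rpow_natCast]
        exact Real.rpow_le_rpow_of_exponent_ge (by positivity) (pow_le_one₀ hβ hβ1) hm
    rw [h3] at h2
    have h5 : 0 ≤ δ * (r ^ κ * Real.exp (γ * F) * (Real.exp (t * F) * β ^ (m + 1)) ^ 2) := by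
      positivity
    have h6 : Real.exp (t * F) ^ 2 * (M * (R ^ 2)⁻¹ * (β ^ m) ^ 2) ≤
        M * (M / δ) ^ (2 * t / γ) * R ^ (-2 - 2 * t * ((κ + 2) / γ)) := by
      rw [hR2]
      calc _ ≤ Real.exp (t * F) ^ 2 * (M * (R ^ 2)⁻¹ * (β ^ 2) ^ (2 * t / γ)) := by gcongr
        _ = M * (R ^ 2)⁻¹ * (Real.exp (t * F) ^ 2 * (β ^ 2) ^ (2 * t / γ)) := by ring
        _ ≤ M * (R ^ 2)⁻¹ * ((M / δ) ^ (2 * t / γ) * (R ^ (-(κ + 2))) ^ (2 * t / γ)) := by gcongr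
        _ = _ := by ring
    linarith

theorem gradient_bump_eq_zero (β : ContDiffBump (0 : 𝔼)) {y : 𝔼}
    (hy : ‖y‖ < β.rIn ∨ β.rOut < ‖y‖) : ∇ (β : 𝔼 → ℝ) y = 0 := by
  rcases hy with hy | hy
  · have := β.eventuallyEq_one_of_mem_ball (x := y) (by simpa using hy)
    rw [this.gradient_eq]
    exact gradient_fun_const y (1 : ℝ)
  · refine gradient_eq_zero_of_notMem_tsupport ?_
    rw [β.tsupport_eq]
    simpa using hy

/-- A weighted superlinear energy inequality has no solution when the scaling exponent
`N - 2 - 2 t (κ + 2) / γ` is negative. -/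
theorem false_of_superlinear_energy (hN : N ≠ 0) {F : 𝔼 → ℝ} (hF : Continuous F)
    {κ γ t C : ℝ} (hκ : 0 ≤ κ) (hγ : 0 < γ) (ht : 0 < t)
    (hdim : (N : ℝ) < 2 + 2 * t * ((κ + 2) / γ))
    (h : ∀ χ : 𝔼 → ℝ, ContDiff ℝ 1 χ → HasCompactSupport χ →
      ∫ x, ‖x‖ ^ κ * Real.exp (γ * F x) * (Real.exp (t * F x) * χ x) ^ 2 ≤
        C * ∫ x, Real.exp (t * F x) ^ 2 * ‖∇ χ x‖ ^ 2) : False := by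
  obtain ⟨C', hC'0, hC'⟩ : ∃ C' : ℝ, 0 < C' ∧ C ≤ C' := ⟨|C| + 1, by positivity, by
    linarith [le_abs_self C]⟩
  let β : ContDiffBump (0 : 𝔼) := ⟨1, 2, one_pos, one_lt_two⟩
  have hβC : ContDiff ℝ 1 (β : 𝔼 → ℝ) := β.contDiff
  have hβd : Differentiable ℝ (β : 𝔼 → ℝ) := hβC.differentiable (by norm_num)
  obtain ⟨m, hm⟩ := exists_nat_ge (2 * t / γ)
  obtain ⟨S, hS⟩ := (continuous_gradient hβC).norm.bounded_above_of_compact_support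
    (HasCompactSupport.intro β.hasCompactSupport fun x hx => by
      rw [gradient_eq_zero_of_notMem_tsupport hx, norm_zero])
  simp only [norm_norm] at hS
  have hS0 : 0 ≤ S := (norm_nonneg _).trans (hS 0)
  set M : ℝ := ((m : ℝ) + 1) ^ 2 * S ^ 2 with hM
  have hM0 : 0 ≤ M := by positivity
  set δ : ℝ := 1 / (2 * C') with hδ
  have hδ0 : 0 < δ := by positivity
  set K : ℝ := M * (M / δ) ^ (2 * t / γ) with hK
  have hK0 : 0 ≤ K := by positivity
  set e : ℝ := -2 - 2 * t * ((κ + 2) / γ) with he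
  -- the cutoff at scale `R` is `χ R = (b R) ^ (m + 1)`; the power makes `|∇ χ|²` of lower order
  set b : ℝ → 𝔼 → ℝ := fun R x => β ((0 : 𝔼) + R⁻¹ • x) with hb
  have hbC : ∀ R, ContDiff ℝ 1 (b R) := fun R => hβC.comp (by fun_prop)
  have hb0 : ∀ R x, 0 ≤ b R x := fun R x => β.nonneg
  have hb1 : ∀ R x, b R x ≤ 1 := fun R x => β.le_one
  have hbone : ∀ R x, 0 < R → ‖x‖ ≤ R → b R x = 1 := fun R x hR hx => by
    refine β.one_of_mem_closedBall ?_
    rw [mem_closedBall_zero_iff, zero_add, norm_smul, Real.norm_of_nonneg (by positivity),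
      inv_mul_le_iff₀ hR]
    simpa [β] using hx
  have hbzero : ∀ R x, 0 < R → 2 * R ≤ ‖x‖ → b R x = 0 := fun R x hR hx => by
    refine β.zero_of_le_dist ?_
    rw [dist_zero_right, zero_add, norm_smul, Real.norm_of_nonneg (by positivity),
      le_inv_mul_iff₀ hR]
    simp only [β]
    linarith
  have hbc : ∀ R, 0 < R → HasCompactSupport (b R) := fun R hR =>
    HasCompactSupport.intro (isCompact_closedBall (0 : 𝔼) (2 * R)) fun x hx => by
      refine hbzero R x hR ?_
      have : 2 * R < ‖x‖ := by simpa using hx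
      exact this.le
  set χ : ℝ → 𝔼 → ℝ := fun R x => b R x ^ (m + 1) with hχ
  have hχC : ∀ R, ContDiff ℝ 1 (χ R) := fun R => (hbC R).pow _
  have hχc : ∀ R, 0 < R → HasCompactSupport (χ R) := fun R hR =>
    (hbc R hR).comp_left (g := fun s : ℝ => s ^ (m + 1)) (by simp)
  have hgrad : ∀ R, 0 < R → ∀ x, ‖∇ (χ R) x‖ ^ 2 ≤ M * (R ^ 2)⁻¹ * (b R x ^ m) ^ 2 ∧
      (‖x‖ < R ∨ 2 * R < ‖x‖ → ‖∇ (χ R) x‖ ^ 2 = 0) := by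
    intro R hR x
    have e1 : ∇ (χ R) x = (((m : ℝ) + 1) * b R x ^ m) • R⁻¹ • ∇ (β : 𝔼 → ℝ) (R⁻¹ • x) := by
      have h1 := gradient_comp' (hasDerivAt_pow (m + 1) (b R x))
        ((hbC R).differentiable (by norm_num) x)
      simp only [hχ]
      rw [h1, hb, gradient_comp_const_smul hβd, zero_add]
      push_cast
      rfl
    have e2 : ‖∇ (χ R) x‖ ^ 2 =
        ((m : ℝ) + 1) ^ 2 * ‖∇ (β : 𝔼 → ℝ) (R⁻¹ • x)‖ ^ 2 * (R ^ 2)⁻¹ * (b R x ^ m) ^ 2 := by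
      rw [e1, norm_smul, norm_smul]
      simp only [mul_pow, Real.norm_eq_abs, sq_abs, inv_pow]
      ring
    have e3 : ‖R⁻¹ • x‖ = R⁻¹ * ‖x‖ := by
      rw [norm_smul, Real.norm_of_nonneg (by positivity)]
    constructor
    · rw [e2, hM]
      gcongr
      exact hS _
    · intro hx
      rw [e2, gradient_bump_eq_zero β]
      · simp
      · rw [e3]
        simp only [β]
        rcases hx with hx | hx
        · left
          rwa [inv_mul_lt_iff₀ hR, mul_one]
        · right
          rwa [lt_inv_mul_iff₀ hR, mul_comm]
  have cg : Continuous fun x => ‖x‖ ^ κ * Real.exp (γ * F x) :=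
    (continuous_norm_rpow hκ).mul (by fun_prop)
  have ct : Continuous fun x => Real.exp (t * F x) := by fun_prop
  have iI : ∀ R, 0 < R → Integrable fun x =>
      ‖x‖ ^ κ * Real.exp (γ * F x) * (Real.exp (t * F x) * χ R x) ^ 2 := fun R hR =>
    integrable_of_eq_zero_off (hχc R hR) (cg.mul ((ct.mul (hχC R).continuous).pow 2))
      fun x hx => by simp [image_eq_zero_of_notMem_tsupport hx]
  have iG : ∀ R, 0 < R → Integrable fun x => Real.exp (t * F x) ^ 2 * ‖∇ (χ R) x‖ ^ 2 :=
    fun R hR => integrable_norm_gradient_sq (ct.pow 2) (hχC R) (hχc R hR)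
  have ib : ∀ R, 0 < R → Integrable (b R) := fun R hR =>
    (hbC R).continuous.integrable_of_hasCompactSupport (hbc R hR)
  set I : ℝ → ℝ := fun R =>
    ∫ x, ‖x‖ ^ κ * Real.exp (γ * F x) * (Real.exp (t * F x) * χ R x) ^ 2 with hI
  set B : ℝ := ∫ x, (β : 𝔼 → ℝ) x with hB
  -- with `C' δ = 1 / 2` the superlinear part of the cutoff term is absorbed by the left side
  have decay : ∀ R, 1 ≤ R → I R ≤ 2 * C' * K * 2 ^ N * B * R ^ ((N : ℝ) + e) := by
    intro R hR1
    have hR : 0 < R := by linarith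
    have h2R : 0 < 2 * R := by linarith
    have e1 : ∫ x, Real.exp (t * F x) ^ 2 * ‖∇ (χ R) x‖ ^ 2 ≤
        ∫ x, (δ * (‖x‖ ^ κ * Real.exp (γ * F x) * (Real.exp (t * F x) * χ R x) ^ 2) +
          K * R ^ e * b (2 * R) x) := by
      refine integral_mono (iG R hR) (((iI R hR).const_mul _).add ((ib _ h2R).const_mul _))
        fun x => ?_
      simp only
      have p1 : 0 ≤ δ * (‖x‖ ^ κ * Real.exp (γ * F x) * (Real.exp (t * F x) * χ R x) ^ 2) := by
        positivity
      have p2 : 0 ≤ K * R ^ e * b (2 * R) x :=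
        mul_nonneg (by positivity) (hb0 _ _)
      by_cases hx : ‖x‖ < R ∨ 2 * R < ‖x‖
      · rw [(hgrad R hR x).2 hx, mul_zero]
        linarith
      · push Not at hx
        rw [hbone (2 * R) x h2R hx.2, mul_one]
        exact (mul_le_mul_of_nonneg_left (hgrad R hR x).1 (by positivity)).trans
          (cutoff_term_le hκ hγ ht hδ0 hM0 hR hx.1 (hb0 R x) (hb1 R x) hm)
    rw [integral_add ((iI R hR).const_mul _) ((ib _ h2R).const_mul _), integral_const_mul,
      integral_const_mul] at e1
    have e2 : ∫ x, b (2 * R) x = 2 ^ N * R ^ (N : ℝ) * B := by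
      simp only [hb, zero_add]
      rw [Measure.integral_comp_inv_smul volume (β : 𝔼 → ℝ) (2 * R), finrank_euclideanSpace,
        Fintype.card_fin, abs_of_pos (by positivity), smul_eq_mul, mul_pow, Real.rpow_natCast]
    have e3 : I R ≤ C' * (δ * I R + K * R ^ e * (2 ^ N * R ^ (N : ℝ) * B)) := by
      have h0 : 0 ≤ ∫ x, Real.exp (t * F x) ^ 2 * ‖∇ (χ R) x‖ ^ 2 :=
        integral_nonneg fun x => by positivity
      calc I R ≤ C * ∫ x, Real.exp (t * F x) ^ 2 * ‖∇ (χ R) x‖ ^ 2 :=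
            h _ (hχC R) (hχc R hR)
        _ ≤ C' * ∫ x, Real.exp (t * F x) ^ 2 * ‖∇ (χ R) x‖ ^ 2 := by gcongr
        _ ≤ _ := by
            rw [← e2]
            exact mul_le_mul_of_nonneg_left e1 hC'0.le
    have e4 : C' * δ = 1 / 2 := by rw [hδ]; field_simp
    have e5 : R ^ ((N : ℝ) + e) = R ^ (N : ℝ) * R ^ e := Real.rpow_add hR _ _
    rw [e5]
    have e6 : C' * (δ * I R + K * R ^ e * (2 ^ N * R ^ (N : ℝ) * B)) =
        1 / 2 * I R + C' * (K * R ^ e * (2 ^ N * R ^ (N : ℝ) * B)) := by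
      rw [← e4]; ring
    rw [e6] at e3
    linarith
  have hIpos : 0 < I 1 := by
    have : Nonempty (Fin N) := ⟨⟨0, Nat.pos_of_ne_zero hN⟩⟩
    obtain ⟨y, hy⟩ := exists_norm_eq 𝔼 (c := 1) (by norm_num)
    refine (cg.mul ((ct.mul (hχC 1).continuous).pow
      2)).integral_pos_of_hasCompactSupport_nonneg_nonzero ?_ (fun x => by positivity) (x := y) ?_
    · exact HasCompactSupport.intro (hχc 1 one_pos) fun x hx => by
        simp [image_eq_zero_of_notMem_tsupport hx]
    · simp only [hχ]
      rw [hbone 1 y one_pos hy.le, hy]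
      simp [Real.exp_ne_zero]
  have hmono : ∀ R, 2 ≤ R → I 1 ≤ I R := by
    intro R hR
    refine integral_mono (iI 1 one_pos) (iI R (by linarith)) fun x => ?_
    simp only
    refine mul_le_mul_of_nonneg_left ?_ (by positivity)
    have : χ 1 x ≤ χ R x := by
      simp only [hχ]
      rcases le_or_gt ‖x‖ 2 with hx | hx
      · rw [hbone R x (by linarith) (by linarith), one_pow]
        exact pow_le_one₀ (hb0 _ _) (hb1 _ _)
      · rw [hbzero 1 x one_pos (by linarith)]
        simp only [ne_eq, Nat.add_eq_zero_iff, one_ne_zero, and_false, not_false_eq_true, zero_pow]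
        exact pow_nonneg (hb0 _ _) _
    have h0 : 0 ≤ χ 1 x := pow_nonneg (hb0 _ _) _
    gcongr
  have hlim : Tendsto (fun R : ℝ => 2 * C' * K * 2 ^ N * B * R ^ ((N : ℝ) + e)) atTop (𝓝 0) := by
    have := (tendsto_rpow_neg_atTop (y := -((N : ℝ) + e)) (by linarith)).const_mul
      (2 * C' * K * 2 ^ N * B)
    simpa using this
  obtain ⟨R, hR1, hR2⟩ := ((hlim.eventually_lt_const hIpos).and (eventually_ge_atTop 2)).exists
  exact absurd ((hmono R hR2).trans (decay R (by linarith))) (not_le.2 hR1)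

/-! ### Consequences for stable solutions of the system -/

namespace IsPositiveSolution

theorem superPotential_u {p q a b : ℝ} {u v : 𝔼 → ℝ}
    (h : IsPositiveSolution N p q a b u v) (x : 𝔼) :
    superPotential (fun y => Real.log (u y)) x = ‖x‖ ^ a * v x ^ p / u x := by
  rw [superPotential_log h.contDiff_u h.u_pos, h.eq_u]

theorem superPotential_v {p q a b : ℝ} {u v : 𝔼 → ℝ}
    (h : IsPositiveSolution N p q a b u v) (x : 𝔼) :
    superPotential (fun y => Real.log (v y)) x = ‖x‖ ^ b * u x ^ q / v x := by
  rw [superPotential_log h.contDiff_v h.v_pos, h.eq_v]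

theorem superPotential_u_nonneg {p q a b : ℝ} {u v : 𝔼 → ℝ}
    (h : IsPositiveSolution N p q a b u v) (x : 𝔼) :
    0 ≤ superPotential (fun y => Real.log (u y)) x := by
  have := h.u_pos x
  have := h.v_pos x
  rw [h.superPotential_u]
  positivity

theorem superPotential_v_nonneg {p q a b : ℝ} {u v : 𝔼 → ℝ}
    (h : IsPositiveSolution N p q a b u v) (x : 𝔼) :
    0 ≤ superPotential (fun y => Real.log (v y)) x := by
  have := h.u_pos x
  have := h.v_pos x
  rw [h.superPotential_v]
  positivity

end IsPositiveSolution

/-- The geometric mean of `-Δ u / u` and `-Δ v / v`; for a solution of the system it is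
`|x|^{(a+b)/2} v^{(p-1)/2} u^{(q-1)/2}`. -/
noncomputable def couplingPotential (u v : 𝔼 → ℝ) (x : 𝔼) : ℝ :=
  √(superPotential (fun y => Real.log (u y)) x * superPotential (fun y => Real.log (v y)) x)

theorem IsPositiveSolution.continuous_couplingPotential {p q a b : ℝ} {u v : 𝔼 → ℝ}
    (h : IsPositiveSolution N p q a b u v) : Continuous (couplingPotential u v) :=
  ((continuous_superPotential (contDiff_log h.contDiff_u h.u_pos)).mul
    (continuous_superPotential (contDiff_log h.contDiff_v h.v_pos))).sqrt

/-- Pointwise stability gives a scalar stability inequality: average the inequalities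
`∫ (-Δ S / S) φ² ≤ ∫ |∇ φ|²` for the two components `S` of the linearization and use that the
product of their potentials `-Δ S / S` is `p q` times `(Δ u / u) (Δ v / v)`. -/
theorem stability_inequality {p q a b : ℝ} {u v : 𝔼 → ℝ}
    (h : IsPositiveSolution N p q a b u v) (hs : IsPointwiseStable N p q a b u v)
    (hp : 0 < p) (hq : 0 < q) {φ : 𝔼 → ℝ} (hφ : ContDiff ℝ 1 φ) (hc : HasCompactSupport φ) :
    √(p * q) * ∫ x, couplingPotential u v x * φ x ^ 2 ≤ ∫ x, ‖∇ φ x‖ ^ 2 := by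
  obtain ⟨ζ, η, hζ, hη, ζpos, ηpos, eζ, eη⟩ := hs
  have i1 := integral_superPotential_mul_sq_le (contDiff_log hζ ζpos) hφ hc
  have i2 := integral_superPotential_mul_sq_le (contDiff_log hη ηpos) hφ hc
  have j1 := integrable_superPotential_mul_sq (contDiff_log hζ ζpos) hφ hc
  have j2 := integrable_superPotential_mul_sq (contDiff_log hη ηpos) hφ hc
  have j3 : Integrable fun x => couplingPotential u v x * φ x ^ 2 :=
    integrable_of_eq_zero_off hc (h.continuous_couplingPotential.mul (hφ.continuous.pow 2))
      fun x hx => by rw [image_eq_zero_of_notMem_tsupport hx]; ring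
  have key : ∫ x, 2 * √(p * q) * (couplingPotential u v x * φ x ^ 2) ≤
      ∫ x, (superPotential (fun y => Real.log (ζ y)) x * φ x ^ 2 +
        superPotential (fun y => Real.log (η y)) x * φ x ^ 2) := by
    refine integral_mono (j3.const_mul _) (j1.add j2) fun x => ?_
    simp only
    rw [← add_mul, ← mul_assoc]
    refine mul_le_mul_of_nonneg_right ?_ (sq_nonneg _)
    have hu := h.u_pos x
    have hv := h.v_pos x
    have hζx := ζpos x
    have hηx := ηpos x
    rw [superPotential_log hζ ζpos, superPotential_log hη ηpos, eζ, eη, couplingPotential,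
      h.superPotential_u, h.superPotential_v, mul_assoc, ← Real.sqrt_mul (by positivity)]
    set s₁ := p * ‖x‖ ^ a * v x ^ (p - 1) * η x / ζ x with hs1
    set s₂ := q * ‖x‖ ^ b * u x ^ (q - 1) * ζ x / η x with hs2
    have e : p * q * (‖x‖ ^ a * v x ^ p / u x * (‖x‖ ^ b * u x ^ q / v x)) = s₁ * s₂ := by
      rw [hs1, hs2, Real.rpow_sub_one hv.ne', Real.rpow_sub_one hu.ne']
      field_simp
    have p1 : 0 ≤ s₁ := by positivity
    have p2 : 0 ≤ s₂ := by positivity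
    rw [e]
    have : √(s₁ * s₂) ≤ (s₁ + s₂) / 2 := by
      rw [Real.sqrt_le_left (by positivity)]
      nlinarith [sq_nonneg (s₁ - s₂)]
    linarith
  rw [integral_add j1 j2, integral_const_mul] at key
  linarith

/-- The comparison property, in terms of `-Δ u / u` and `-Δ v / v`. -/
theorem superPotential_comparison {p q a b : ℝ} {u v : 𝔼 → ℝ}
    (h : IsPositiveSolution N p q a b u v)
    (hN : N ≠ 0) (hp : 0 < p) (hq : 0 < q) (hqp : q ≤ p) (hb : 0 ≤ b) (hab : 0 ≤ a - b)
    (hab' : a - b ≤ ((N : ℝ) - 2) * (p - q)) (x : 𝔼) :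
    superPotential (fun y => Real.log (u y)) x ≤
      (p + 1) / (q + 1) * superPotential (fun y => Real.log (v y)) x := by
  have hc := comparison h hN hp hq hqp hb hab hab' x
  have hu := h.u_pos x
  have hv := h.v_pos x
  rw [h.superPotential_u, h.superPotential_v, div_mul_div_comm, div_le_div_iff₀ hu (by positivity)]
  rw [Real.rpow_add_one hv.ne', Real.rpow_add_one hu.ne'] at hc
  linarith

theorem superPotential_le_couplingPotential {p q a b : ℝ} {u v : 𝔼 → ℝ}
    (h : IsPositiveSolution N p q a b u v) {k : ℝ} (hk : 0 < k) {x : 𝔼}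
    (hc : superPotential (fun y => Real.log (u y)) x ≤
      k * superPotential (fun y => Real.log (v y)) x) :
    superPotential (fun y => Real.log (u y)) x ≤ √k * couplingPotential u v x := by
  rw [couplingPotential, ← Real.sqrt_mul hk.le]
  refine Real.le_sqrt_of_sq_le ?_
  have := h.superPotential_u_nonneg x
  nlinarith

/-- The energy estimate for `θ = p q / k > 1` and exponents below the critical one. -/
theorem energy_of_one_lt_theta {p q a b : ℝ} {u v : 𝔼 → ℝ}
    (h : IsPositiveSolution N p q a b u v) (hs : IsPointwiseStable N p q a b u v)
    (hp : 0 < p) (hq : 0 < q) {k t : ℝ} (hk : 0 < k) (ht : 0 < t)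
    (hc : ∀ x, superPotential (fun y => Real.log (u y)) x ≤
      k * superPotential (fun y => Real.log (v y)) x)
    (htθ : √k / √(p * q) < (2 * t - 1) / t ^ 2) :
    ∃ C : ℝ, ∀ χ : 𝔼 → ℝ, ContDiff ℝ 1 χ → HasCompactSupport χ →
      ∫ x, ‖∇ (fun x => Real.exp (t * Real.log (u x)) * χ x) x‖ ^ 2 ≤
        C * ∫ x, Real.exp (t * Real.log (u x)) ^ 2 * ‖∇ χ x‖ ^ 2 := by
  refine energy_of_form_bound (contDiff_log h.contDiff_u h.u_pos) ht htθ fun φ hφ hφc => ?_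
  have hpq : 0 < √(p * q) := Real.sqrt_pos.2 (by positivity)
  have j3 : Integrable fun x => couplingPotential u v x * φ x ^ 2 :=
    integrable_of_eq_zero_off hφc (h.continuous_couplingPotential.mul (hφ.continuous.pow 2))
      fun x hx => by rw [image_eq_zero_of_notMem_tsupport hx]; ring
  calc ∫ x, superPotential (fun y => Real.log (u y)) x * φ x ^ 2
      ≤ ∫ x, √k * (couplingPotential u v x * φ x ^ 2) := by
        refine integral_mono (integrable_superPotential_mul_sq
          (contDiff_log h.contDiff_u h.u_pos) hφ hφc) (j3.const_mul _) fun x => ?_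
        simp only
        rw [← mul_assoc]
        exact mul_le_mul_of_nonneg_right (superPotential_le_couplingPotential h hk (hc x))
          (sq_nonneg _)
    _ = √k / √(p * q) * (√(p * q) * ∫ x, couplingPotential u v x * φ x ^ 2) := by
        rw [integral_const_mul, ← mul_assoc, div_mul_cancel₀ _ hpq.ne']
    _ ≤ _ := mul_le_mul_of_nonneg_left (stability_inequality h hs hp hq hφ hφc) (by positivity)

/-- The function `(ε + |x|²)^{-τ/2}` is superharmonic for `0 ≤ τ ≤ N - 2`. -/
theorem superPotential_log_add_norm_sq_nonneg {τ ε : ℝ} (hτ : 0 ≤ τ) (hτN : τ ≤ (N : ℝ) - 2)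
    (hε : 0 < ε) (x : 𝔼) :
    0 ≤ superPotential (fun y : 𝔼 => -(τ / 2) * Real.log (ε + ‖y‖ ^ 2)) x := by
  have hd : 0 < ε + ‖x‖ ^ 2 := by positivity
  have hC := contDiffAt_log_add_norm_sq hd.ne'
  rw [superPotential, laplacian_const_mul' _ hC, laplacian_log_add_norm_sq hd.ne',
    gradient_const_mul' _ (hC.differentiableAt (by norm_num)), gradient_log_add_norm_sq hd.ne',
    norm_smul, norm_smul, mul_pow, mul_pow, Real.norm_eq_abs, Real.norm_eq_abs, sq_abs, sq_abs]
  have e : -(-(τ / 2) * (2 * N / (ε + ‖x‖ ^ 2) - 4 * ‖x‖ ^ 2 / (ε + ‖x‖ ^ 2) ^ 2)) -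
      (-(τ / 2)) ^ 2 * ((2 / (ε + ‖x‖ ^ 2)) ^ 2 * ‖x‖ ^ 2) =
      τ * (N * ε + (N - 2 - τ) * ‖x‖ ^ 2) / (ε + ‖x‖ ^ 2) ^ 2 := by
    field_simp
    ring
  rw [e]
  have : 0 ≤ (N : ℝ) - 2 - τ := by linarith
  positivity

/-- The pointwise hypotheses of `critical_estimate`. Here `w` and `z` stand for `u²` and for the
square of the power of `v` compared with `u`, and `X / (k Y) ≤ 1` measures the deficit in the
comparison property. The first inequality uses `e ≥ 1`; in the second, either `4 X ≤ k Y` and the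
deficit is at least `X`, or `z` is bounded below by a multiple of `w`. -/
theorem critical_pointwise {k X Y e M M₀ w z : ℝ} (hk : 0 < k) (hX : 0 < X) (hY : 0 < Y)
    (hXY : X ≤ k * Y) (he : 1 ≤ e) (hM : 1 ≤ M) (hM₀ : M ≤ M₀) (hw : 0 ≤ w)
    (hz : z = M * (w * (X / (k * Y)) ^ e)) :
    ((k * Y - X) * z ≤ (2 * M₀ + 1 + k * 4 ^ e) * ((√k * √(X * Y) - X) * w)) ∧
      (X * w ≤ (2 * M₀ + 1 + k * 4 ^ e) * ((√k * √(X * Y) - X) * w + Y * z)) ∧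
      z ≤ (2 * M₀ + 1 + k * 4 ^ e) * w := by
  have hkY : 0 < k * Y := by positivity
  set r := X / (k * Y) with hr
  have hr0 : 0 < r := by positivity
  have hr1 : r ≤ 1 := by rw [hr, div_le_one hkY]; exact hXY
  have hre : r ^ e ≤ r := by
    simpa using Real.rpow_le_rpow_of_exponent_ge hr0 hr1 he
  have hX' : X = r * (k * Y) := by rw [hr]; field_simp
  set x := √X with hx
  set y := √(k * Y) with hy
  have hx0 : 0 < x := Real.sqrt_pos.2 hX
  have hy0 : 0 < y := Real.sqrt_pos.2 hkY
  have hx2 : x ^ 2 = X := Real.sq_sqrt hX.le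
  have hy2 : y ^ 2 = k * Y := Real.sq_sqrt hkY.le
  have hxy : x ≤ y := Real.sqrt_le_sqrt hXY
  have hD : √k * √(X * Y) - X = x * (y - x) := by
    rw [← Real.sqrt_mul hk.le, show k * (X * Y) = X * (k * Y) by ring, Real.sqrt_mul hX.le,
      ← hx, ← hy, mul_sub, ← sq, hx2]
  have hD0 : 0 ≤ x * (y - x) := mul_nonneg hx0.le (by linarith)
  have h4 : 0 < k * 4 ^ e := by positivity
  have hM0 : 0 < M₀ := by linarith
  have hzle : z ≤ M₀ * (w * r) := by
    rw [hz]
    gcongr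
  have hz0 : 0 ≤ z := by rw [hz]; positivity
  rw [hD]
  refine ⟨?_, ?_, ?_⟩
  · have e1 : k * Y - X = (y - x) * (y + x) := by rw [← hx2, ← hy2]; ring
    have e2 : r * y ^ 2 = x ^ 2 := by rw [hy2, hx2, ← hX']
    have e3 : (y + x) * r ≤ 2 * x := by
      have h5 : y * r ≤ x := by
        have : y * (y * r) ≤ y * x := by nlinarith
        exact le_of_mul_le_mul_left this hy0
      nlinarith
    calc (k * Y - X) * z ≤ (y - x) * (y + x) * (M₀ * (w * r)) := by
          rw [e1]
          exact mul_le_mul_of_nonneg_left hzle (mul_nonneg (by linarith) (by linarith))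
      _ = M₀ * w * (y - x) * ((y + x) * r) := by ring
      _ ≤ M₀ * w * (y - x) * (2 * x) := by
          refine mul_le_mul_of_nonneg_left e3 (mul_nonneg (by positivity) (by linarith))
      _ = 2 * M₀ * (x * (y - x) * w) := by ring
      _ ≤ _ := by
          refine mul_le_mul_of_nonneg_right (by linarith) (mul_nonneg hD0 hw)
  · rcases le_or_gt (4 * X) (k * Y) with hc | hc
    · have h5 : 2 * x ≤ y := by
        refine abs_le_of_sq_le_sq' ?_ hy0.le |>.2
        nlinarith
      have h6 : X * w ≤ x * (y - x) * w := by
        refine mul_le_mul_of_nonneg_right ?_ hw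
        rw [← hx2, sq]
        exact mul_le_mul_of_nonneg_left (by linarith) hx0.le
      calc X * w ≤ 1 * (x * (y - x) * w + Y * z) := by
            have : 0 ≤ Y * z := by positivity
            linarith
        _ ≤ _ := by
            refine mul_le_mul_of_nonneg_right (by linarith) ?_
            have := mul_nonneg hD0 hw
            positivity
    · have h5 : (1 / 4 : ℝ) ≤ r := by
        rw [hr, le_div_iff₀ hkY]
        linarith
      have h6 : (1 / 4 : ℝ) ^ e ≤ r ^ e := Real.rpow_le_rpow (by norm_num) h5 (by linarith)
      have h7 : 1 ≤ 4 ^ e * r ^ e := by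
        have : (4 : ℝ) ^ e * (1 / 4 : ℝ) ^ e = 1 := by
          rw [← Real.mul_rpow (by norm_num) (by norm_num)]
          norm_num
        rw [← this]
        gcongr
      have h8 : w ≤ 4 ^ e * z := by
        rw [hz]
        calc w ≤ 4 ^ e * r ^ e * w := le_mul_of_one_le_left hw h7
          _ = 4 ^ e * (1 * (w * r ^ e)) := by ring
          _ ≤ _ := by gcongr
      calc X * w ≤ k * Y * (4 ^ e * z) := by gcongr
        _ = k * 4 ^ e * (Y * z) := by ring
        _ ≤ (2 * M₀ + 1 + k * 4 ^ e) * (x * (y - x) * w + Y * z) := by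
            have := mul_nonneg hD0 hw
            gcongr
            · linarith
            · linarith
  · calc z ≤ M₀ * (w * r) := hzle
      _ ≤ M₀ * (w * 1) := by gcongr
      _ = M₀ * w := by ring
      _ ≤ _ := mul_le_mul_of_nonneg_right (by linarith) hw

/-- The energy estimate for `θ = 1` and `t = 1`. Here `p q = k > 1` forces `q < 1 < p`, and the
superharmonic function `h` is `(ε² + |x|²)^{-τ/2}` with `τ = (a - b) / (p - q)`: it is smooth, and
comparable to `|x|^{-τ}` on the support of `χ` with constants independent of `ε`. -/
theorem energy_of_theta_eq_one {p q a b : ℝ} {u v : 𝔼 → ℝ}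
    (h : IsPositiveSolution N p q a b u v) (hs : IsPointwiseStable N p q a b u v)
    (hp : 0 < p) (hq : 0 < q) (hN : 3 ≤ N) (hpq : 1 < p * q) (hab : 0 ≤ a - b)
    (hab' : a - b ≤ ((N : ℝ) - 2) * (p - q)) (hθ : p * q = (p + 1) / (q + 1))
    (hc : ∀ x, superPotential (fun y => Real.log (u y)) x ≤
      (p + 1) / (q + 1) * superPotential (fun y => Real.log (v y)) x) :
    ∃ C : ℝ, ∀ χ : 𝔼 → ℝ, ContDiff ℝ 1 χ → HasCompactSupport χ →
      ∫ x, ‖∇ (fun x => Real.exp (1 * Real.log (u x)) * χ x) x‖ ^ 2 ≤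
        C * ∫ x, Real.exp (1 * Real.log (u x)) ^ 2 * ‖∇ χ x‖ ^ 2 := by
  set k := (p + 1) / (q + 1) with hkdef
  have hk1 : 1 < k := hθ ▸ hpq
  have hk0 : 0 < k := by linarith
  have hqp : q < p := by
    rw [hkdef, one_lt_div (by linarith)] at hk1
    linarith
  have hq1 : q < 1 := by
    by_contra! hq1
    rw [hkdef, eq_div_iff (by positivity)] at hθ
    nlinarith
  set U := fun y => Real.log (u y) with hU
  set V := fun y => Real.log (v y) with hV
  have hUC : ContDiff ℝ 2 U := contDiff_log h.contDiff_u h.u_pos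
  have hVC : ContDiff ℝ 2 V := contDiff_log h.contDiff_v h.v_pos
  set e := 2 / (q + 1) with he
  have he1 : 1 ≤ e := by rw [he, one_le_div (by linarith)]; linarith
  set s := (a - b) / (q + 1) with hsdef
  have hs0 : 0 ≤ s := by positivity
  set M₀ := (2 : ℝ) ^ s with hM₀
  set C := 2 * M₀ + 1 + k * 4 ^ e with hC
  have hM₀pos : 0 < M₀ := by positivity
  have hC0 : 0 < C := by positivity
  set τ := (a - b) / (p - q) with hτ
  have hpq0 : 0 < p - q := by linarith
  have hτ0 : 0 ≤ τ := by positivity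
  have hτN : τ ≤ (N : ℝ) - 2 := by rw [hτ, div_le_iff₀ hpq0]; exact hab'
  have hkτ : (1 - k) * τ = -s := by
    rw [hkdef, hτ, hsdef]
    field_simp
    ring
  have hcm : Continuous (couplingPotential u v) := h.continuous_couplingPotential
  set C₁ := C * (1 + 3 / (k - 1) * (2 * C) + C) with hC₁
  have hC₁0 : 0 ≤ C₁ := by
    have : 0 < k - 1 := by linarith
    positivity
  have cU : Continuous fun x => Real.exp (1 * U x) :=
    (continuous_const.mul hUC.continuous).rexp
  have key : ∀ χ : 𝔼 → ℝ, ContDiff ℝ 1 χ → HasCompactSupport χ →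
      ∫ x, superPotential U x * Real.exp (1 * U x) ^ 2 * χ x ^ 2 ≤
        2 * C₁ * ∫ x, Real.exp (1 * U x) ^ 2 * ‖∇ χ x‖ ^ 2 := by
    intro χ hχ hcs
    refine extend_across_origin hN ((continuous_superPotential hUC).mul (cU.pow 2)) (cU.pow 2)
      (fun x => sq_nonneg _) hC₁0 (fun χ hχ hcs h0 => ?_) hχ hcs
    obtain ⟨ε, hε, hεχ⟩ := Metric.isOpen_iff.1 (isClosed_tsupport χ).isOpen_compl 0 h0
    have hnorm : ∀ x ∈ tsupport χ, ε ≤ ‖x‖ := fun x hx => by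
      by_contra! hlt
      exact hεχ (by simpa using hlt) hx
    set P : 𝔼 → ℝ := fun y => -(τ / 2) * Real.log (ε ^ 2 + ‖y‖ ^ 2) with hP
    have hPC : ContDiff ℝ 2 P := by
      refine contDiff_const.mul ?_
      rw [contDiff_iff_contDiffAt]
      intro x
      exact contDiffAt_log_add_norm_sq (by positivity)
    set L := ∫ x, Real.exp (1 * U x) ^ 2 * ‖∇ χ x‖ ^ 2 with hL
    set φ : 𝔼 → ℝ := fun x => Real.exp (1 * U x) * χ x with hφ
    have hφC : ContDiff ℝ 1 φ := contDiff_exp_mul (contDiff_const.mul hUC) hχ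
    have hφc : HasCompactSupport φ := hcs.mul_left
    have j3 : Integrable fun x => couplingPotential u v x * φ x ^ 2 :=
      integrable_of_eq_zero_off hφc (hcm.mul (hφC.continuous.pow 2))
        fun x hx => by rw [image_eq_zero_of_notMem_tsupport hx]; ring
    have hD : ∫ x, (√k * couplingPotential u v x - superPotential U x) * φ x ^ 2 ≤ L := by
      have h1 := stability_inequality h hs hp hq hφC hφc
      rw [hθ, integral_norm_gradient_exp_mul hUC hχ hcs] at h1
      simp_rw [sub_mul, mul_assoc]
      rw [integral_sub (j3.const_mul _) (integrable_superPotential_mul_sq hUC hφC hφc),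
        integral_const_mul]
      linarith
    set c := -(Real.log k / (q + 1)) with hcdef
    have hpt : ∀ x ∈ tsupport χ,
        ((k * superPotential V x - superPotential U x) *
          Real.exp (c + (k * V x + (1 - k) * P x)) ^ 2 ≤
            C * ((√k * couplingPotential u v x - superPotential U x) * Real.exp (1 * U x) ^ 2)) ∧
        (superPotential U x * Real.exp (1 * U x) ^ 2 ≤
          C * ((√k * couplingPotential u v x - superPotential U x) * Real.exp (1 * U x) ^ 2 +
            superPotential V x * Real.exp (c + (k * V x + (1 - k) * P x)) ^ 2)) ∧
        Real.exp (c + (k * V x + (1 - k) * P x)) ^ 2 ≤ C * Real.exp (1 * U x) ^ 2 := by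
      intro x hx
      have hxε := hnorm x hx
      have hr : 0 < ‖x‖ := hε.trans_le hxε
      have hu := h.u_pos x
      have hv := h.v_pos x
      have hX : 0 < superPotential U x := by rw [hU, h.superPotential_u]; positivity
      have hY : 0 < superPotential V x := by rw [hV, h.superPotential_v]; positivity
      refine critical_pointwise (M := ((ε ^ 2 + ‖x‖ ^ 2) / ‖x‖ ^ 2) ^ s) hk0 hX hY (hc x) he1
        (Real.one_le_rpow ?_ hs0) (Real.rpow_le_rpow (by positivity) ?_ hs0) (by positivity) ?_
      · rw [one_le_div (by positivity)]
        linarith [sq_nonneg ε]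
      · rw [div_le_iff₀ (by positivity)]
        have : ε ^ 2 ≤ ‖x‖ ^ 2 := by gcongr
        linarith
      · have hlogr : Real.log (superPotential U x / (k * superPotential V x)) =
            (a - b) * Real.log ‖x‖ + (p + 1) * V x - (q + 1) * U x - Real.log k := by
          rw [hU, hV, h.superPotential_u, h.superPotential_v]
          have r1 : ‖x‖ ^ a ≠ 0 := by positivity
          have r2 : ‖x‖ ^ b ≠ 0 := by positivity
          have r3 : v x ^ p ≠ 0 := by positivity
          have r4 : u x ^ q ≠ 0 := by positivity
          rw [Real.log_div (by positivity) (by positivity), Real.log_mul hk0.ne' (by positivity),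
            Real.log_div (by positivity) hu.ne', Real.log_div (by positivity) hv.ne',
            Real.log_mul r1 r3, Real.log_mul r2 r4, Real.log_rpow hr, Real.log_rpow hr,
            Real.log_rpow hv, Real.log_rpow hu]
          ring
        have hd : 0 < ε ^ 2 + ‖x‖ ^ 2 := by positivity
        rw [Real.rpow_def_of_pos (by positivity), Real.rpow_def_of_pos (by positivity), hlogr,
          Real.log_div hd.ne' (by positivity), Real.log_pow, ← Real.exp_nat_mul,
          ← Real.exp_nat_mul, ← Real.exp_add, ← Real.exp_add]
        congr 1
        have e1 : (1 - k) * P x = s / 2 * Real.log (ε ^ 2 + ‖x‖ ^ 2) := by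
          rw [hP]
          linear_combination (-(1 / 2) * Real.log (ε ^ 2 + ‖x‖ ^ 2)) * hkτ
        rw [e1, hcdef, hkdef, he, hsdef]
        push_cast
        field_simp
        ring
    have hcrit := critical_estimate hUC hVC hPC
      ((continuous_const.mul hcm).sub (continuous_superPotential hUC)) hk1 hC0.le
      (superPotential_log_add_norm_sq_nonneg hτ0 hτN (by positivity)) hχ hcs hD rfl
      (fun x hx => (hpt x hx).1) (fun x hx => (hpt x hx).2.1) (fun x hx => (hpt x hx).2.2)
    calc ∫ x, superPotential U x * Real.exp (1 * U x) ^ 2 * χ x ^ 2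
        = ∫ x, superPotential U x * (Real.exp (1 * U x) * χ x) ^ 2 := by
          simp_rw [mul_pow, mul_assoc]
      _ ≤ _ := hcrit
      _ = C₁ * L := by rw [hC₁, hL]; ring
  refine ⟨2 * C₁ + 1, fun χ hχ hcs => ?_⟩
  rw [integral_norm_gradient_exp_mul hUC hχ hcs, add_mul, one_mul]
  refine add_le_add_left ?_ _
  simp_rw [mul_pow, ← mul_assoc]
  exact key χ hχ hcs

/-- The potentials `√(X Y)` and `Y` together dominate a weighted power of `u` alone, since
`X Y^p = |x|^{a+bp} u^{pq-1}`; here `X = -Δ u / u` and `Y = -Δ v / v`. -/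
theorem IsPositiveSolution.norm_rpow_mul_le {p q a b : ℝ} {u v : 𝔼 → ℝ}
    (h : IsPositiveSolution N p q a b u v) (hp : 1 ≤ p) (x : 𝔼) (ha : 0 ≤ a) (hb : 0 ≤ b) :
    ‖x‖ ^ ((a + b * p) / (p + 1)) * Real.exp ((p * q - 1) / (p + 1) * Real.log (u x)) ≤
      couplingPotential u v x + superPotential (fun y => Real.log (v y)) x := by
  have hu := h.u_pos x
  have hv := h.v_pos x
  have hX0 := h.superPotential_u_nonneg x
  have hY0 := h.superPotential_v_nonneg x
  rw [couplingPotential]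
  set X := superPotential (fun y => Real.log (u y)) x with hX
  set Y := superPotential (fun y => Real.log (v y)) x with hY
  set S := √(X * Y) + Y with hS
  have hS0 : 0 ≤ S := by positivity
  have hp1 : 0 < p + 1 := by linarith
  have e1 : X * Y ^ p = ‖x‖ ^ (a + b * p) * u x ^ (p * q - 1) := by
    rw [hX, hY, h.superPotential_u, h.superPotential_v, Real.div_rpow (by positivity) hv.le,
      Real.mul_rpow (by positivity) (by positivity), ← Real.rpow_mul (norm_nonneg x),
      ← Real.rpow_mul hu.le, Real.rpow_sub_one hu.ne',
      Real.rpow_add_of_nonneg (norm_nonneg x) ha (by positivity), mul_comm q p]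
    field_simp
  have e2 : X * Y ^ p ≤ S ^ (p + 1) := by
    have hYS : Y ≤ S := by rw [hS]; linarith [Real.sqrt_nonneg (X * Y)]
    have hXYS : X * Y ≤ S ^ 2 := by
      have h1 : √(X * Y) ≤ S := by rw [hS]; linarith
      calc X * Y = √(X * Y) ^ 2 := (Real.sq_sqrt (by positivity)).symm
        _ ≤ S ^ 2 := by gcongr
    have e3 : Y ^ p = Y * Y ^ (p - 1) := by
      rcases eq_or_lt_of_le hY0 with h0 | h0
      · rw [← h0, Real.zero_rpow (by linarith), zero_mul]
      · rw [Real.rpow_sub_one h0.ne']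
        field_simp
    have e4 : S ^ (p + 1) = S ^ 2 * S ^ (p - 1) := by
      rw [← Real.rpow_natCast, ← Real.rpow_add_of_nonneg hS0 (by norm_num) (by linarith)]
      congr 1
      push_cast
      ring
    rw [e3, e4, ← mul_assoc]
    exact mul_le_mul hXYS (Real.rpow_le_rpow hY0 hYS (by linarith)) (by positivity) (by positivity)
  have e5 := Real.rpow_le_rpow (by positivity) e2 (show 0 ≤ 1 / (p + 1) by positivity)
  rw [← Real.rpow_mul hS0, mul_one_div_cancel hp1.ne', Real.rpow_one, e1,
    Real.mul_rpow (by positivity) (by positivity), ← Real.rpow_mul (norm_nonneg x),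
    ← Real.rpow_mul hu.le, Real.rpow_def_of_pos hu] at e5
  refine le_trans (le_of_eq ?_) e5
  congr 2 <;> ring

/-- An energy estimate with exponent `t` excludes solutions in dimensions
`N < 2 + 2 t (p (b + 2) + a + 2) / (p q - 1)`. -/
theorem false_of_energy {p q a b : ℝ} {u v : 𝔼 → ℝ}
    (h : IsPositiveSolution N p q a b u v) (hs : IsPointwiseStable N p q a b u v)
    (hN : N ≠ 0) (hp : 1 ≤ p) (hq : 0 < q) (hpq : 1 < p * q) (ha : 0 ≤ a) (hb : 0 ≤ b) {t : ℝ}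
    (ht : 0 < t) (hdim : (N : ℝ) < 2 + 2 * t * ((p * (b + 2) + a + 2) / (p * q - 1)))
    (hE : ∃ C : ℝ, ∀ χ : 𝔼 → ℝ, ContDiff ℝ 1 χ → HasCompactSupport χ →
      ∫ x, ‖∇ (fun x => Real.exp (t * Real.log (u x)) * χ x) x‖ ^ 2 ≤
        C * ∫ x, Real.exp (t * Real.log (u x)) ^ 2 * ‖∇ χ x‖ ^ 2) : False := by
  obtain ⟨C, hE⟩ := hE
  have hp0 : 0 < p := by linarith
  have hpq1 : 0 < p * q - 1 := by linarith
  have hsq : 0 < √(p * q) := Real.sqrt_pos.2 (by positivity)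
  have hUC : ContDiff ℝ 2 fun y => Real.log (u y) := contDiff_log h.contDiff_u h.u_pos
  have hVC : ContDiff ℝ 2 fun y => Real.log (v y) := contDiff_log h.contDiff_v h.v_pos
  refine false_of_superlinear_energy hN hUC.continuous (κ := (a + b * p) / (p + 1))
    (γ := (p * q - 1) / (p + 1)) (t := t) (C := (1 / √(p * q) + 1) * C) (by positivity)
    (by positivity) ht ?_ fun χ hχ hcs => ?_
  · have e : ((a + b * p) / (p + 1) + 2) / ((p * q - 1) / (p + 1)) =
        (p * (b + 2) + a + 2) / (p * q - 1) := by
      field_simp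
      ring
    rwa [e]
  · set φ : 𝔼 → ℝ := fun x => Real.exp (t * Real.log (u x)) * χ x with hφ
    have hφC : ContDiff ℝ 1 φ := contDiff_exp_mul (contDiff_const.mul hUC) hχ
    have hφc : HasCompactSupport φ := hcs.mul_left
    have j3 : Integrable fun x => couplingPotential u v x * φ x ^ 2 :=
      integrable_of_eq_zero_off hφc (h.continuous_couplingPotential.mul (hφC.continuous.pow 2))
        fun x hx => by rw [image_eq_zero_of_notMem_tsupport hx]; ring
    have j4 := integrable_superPotential_mul_sq hVC hφC hφc
    have k1 := stability_inequality h hs hp0 hq hφC hφc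
    have k2 := integral_superPotential_mul_sq_le hVC hφC hφc
    calc ∫ x, ‖x‖ ^ ((a + b * p) / (p + 1)) *
          Real.exp ((p * q - 1) / (p + 1) * Real.log (u x)) *
            (Real.exp (t * Real.log (u x)) * χ x) ^ 2
        ≤ ∫ x, (couplingPotential u v x * φ x ^ 2 +
            superPotential (fun y => Real.log (v y)) x * φ x ^ 2) := by
          refine integral_mono (integrable_of_eq_zero_off hφc ?_ fun x hx => ?_) (j3.add j4)
            fun x => ?_
          · exact ((continuous_norm_rpow (by positivity)).mul
              (continuous_const.mul hUC.continuous).rexp).mul (hφC.continuous.pow 2)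
          · have : φ x = 0 := image_eq_zero_of_notMem_tsupport hx
            simp only [hφ] at this
            rw [this]
            ring
          · simp only
            rw [← add_mul]
            exact mul_le_mul_of_nonneg_right (h.norm_rpow_mul_le hp x ha hb) (sq_nonneg _)
      _ ≤ (1 / √(p * q) + 1) * ∫ x, ‖∇ φ x‖ ^ 2 := by
          rw [integral_add j3 j4, add_mul, one_mul]
          refine add_le_add ?_ k2
          rw [one_div, ← div_eq_inv_mul, le_div_iff₀ hsq]
          linarith
      _ ≤ _ := by
          rw [mul_assoc]
          exact mul_le_mul_of_nonneg_left (hE χ hχ hcs) (by positivity)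

end

theorem theorem4 (N : ℕ) (hN : 1 ≤ N) (p q a b : ℝ)
    (hp : 0 ≤ p) (hq : 0 ≤ q) (ha : 0 ≤ a) (hb : 0 ≤ b) (hpq : 1 < p * q)
    (hab₀ : 0 ≤ a - b) (hab₁ : a - b ≤ ((N : ℝ) - 2) * (p - q))
    -- the outer square root below is that of a non-negative number
    (hθ : 1 ≤ stabTheta p q)
    (hdim : (N : ℝ) < 2 + 2 * ((p * (b + 2) + a + 2) / (p * q - 1)) *
      (√(stabTheta p q) + √(stabTheta p q - √(stabTheta p q)))) :
    ¬ ∃ u v : EuclideanSpace ℝ (Fin N) → ℝ,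
      IsPositiveSolution N p q a b u v ∧ IsPointwiseStable N p q a b u v := by
  rintro ⟨u, v, h, hs⟩
  have hN0 : N ≠ 0 := by omega
  have hp0 : 0 < p := lt_of_le_of_ne hp (by rintro rfl; simp at hpq; linarith)
  have hq0 : 0 < q := lt_of_le_of_ne hq (by rintro rfl; simp at hpq; linarith)
  rcases le_or_gt N 2 with hN2 | hN2
  · have : Nonempty (Fin N) := ⟨⟨0, by omega⟩⟩
    obtain ⟨y, hy⟩ := exists_norm_eq (EuclideanSpace ℝ (Fin N)) (c := 1) (by norm_num)
    have h1 := laplacian_eq_zero_of_dim_le_two hN2 h.contDiff_u h.u_pos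
      (fun x => by
        rw [h.eq_u]
        exact mul_nonneg (by positivity) (Real.rpow_nonneg (h.v_pos x).le _)) y
    rw [h.eq_u, hy, Real.one_rpow, one_mul] at h1
    exact (Real.rpow_pos_of_pos (h.v_pos y) p).ne' h1
  have hN3 : (3 : ℝ) ≤ N := by exact_mod_cast hN2
  have hqp : q ≤ p := by
    by_contra! hlt
    nlinarith
  have hp1 : 1 ≤ p := by
    by_contra! hlt
    nlinarith
  have hc := superPotential_comparison h hN0 hp0 hq0 hqp hb hab₀ hab₁
  set k := (p + 1) / (q + 1) with hk
  have hk0 : 0 < k := by positivity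
  have hθk : stabTheta p q = p * q / k := by
    rw [stabTheta, hk]
    field_simp
  set θ := stabTheta p q with hθdef
  set α := (p * (b + 2) + a + 2) / (p * q - 1) with hα
  have hα0 : 0 < α := by
    have : 0 < p * q - 1 := by linarith
    positivity
  rcases eq_or_lt_of_le hθ with hθ1 | hθ1
  · refine false_of_energy h hs hN0 hp1 hq0 hpq ha hb one_pos ?_
      (energy_of_theta_eq_one h hs hp0 hq0 hN2 hpq hab₀ hab₁ ?_ hc)
    · rw [← hθ1] at hdim
      simpa using hdim
    · rw [← hθ1, eq_div_iff hk0.ne', one_mul] at hθk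
      exact hθk.symm
  · set T := √θ with hT
    have hT1 : 1 < T := by rw [hT, Real.lt_sqrt (by norm_num)]; simpa using hθ1
    have hT2 : T ^ 2 = θ := Real.sq_sqrt (by linarith)
    set D := √(θ - T) with hD
    have hD2 : D ^ 2 = θ - T := Real.sq_sqrt (by nlinarith)
    have hD0 : 0 < D := Real.sqrt_pos.2 (by nlinarith)
    obtain ⟨t, ht1, ht2⟩ : ∃ t, max 1 ((N - 2) / (2 * α)) < t ∧ t < T + D := by
      refine exists_between (max_lt (by linarith) ?_)
      rw [div_lt_iff₀ (by positivity)]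
      linarith
    obtain ⟨ht1, ht3⟩ := max_lt_iff.1 ht1
    have ht0 : 0 < t := by linarith
    rw [div_lt_iff₀ (by positivity)] at ht3
    refine false_of_energy h hs hN0 hp1 hq0 hpq ha hb ht0 (by linarith)
      (energy_of_one_lt_theta h hs hp0 hq0 hk0 ht0 hc ?_)
    have e : √k / √(p * q) = 1 / T := by
      rw [hT, hθk, Real.sqrt_div (x := p * q) (by positivity) k, one_div_div]
    rw [e, div_lt_div_iff₀ (by linarith) (by positivity)]
    -- `t` lies between the roots `T ± D` of `t² - 2 T t + T`; for the lower root, `T - 1 < D`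
    have h1 : -D < t - T := by nlinarith
    have h2 : t - T < D := by linarith
    have h3 : (t - T) ^ 2 < D ^ 2 := sq_lt_sq' h1 h2
    nlinarith
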